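/- **Setting.** Let $\sigma\in(0,2)$, $m\ge 1$, $X,Y,T>0$, $\Omega=(-X,X)\times(0,Y)$, and let $f\ge 0$ on $[-X,X]$. Put $\mu_\sigma=2^{\sigma-1}\Gamma(\sigma/2)/\Gamma(1-\sigma/2)$, $\nu_\sigma=\sigma\mu_\sigma$, $L_\sigma v=\nabla\cdot(y^{1-\sigma}\nabla v)$ and $\frac{\partial v}{\partial y^\sigma}(x,0)=\mu_\sigma\lim_{y\to0^+}y^{1-\sigma}\frac{\partial v}{\partial y}(x,y)$. Let $w=w(x,y,t)\ge 0$ be a classical solution (continuous on $\overline\Omega\times[0,T]$ and $C^2$ in $(x,y)\in\Omega$ for $0<t\le T$) of $$L_\sigma w=0 \text{ in } \Omega,\qquad \frac{\partial w^{1/m}}{\partial t}(x,0,t)=\frac{\partial w}{\partial y^\sigma}(x,0,t)\ \ (|x|\le X),\qquad 0<t\le T,$$ with $w(x,0,0)=f(x)^m$ for $|x|\le X$ and $w=0$ on the rest of $\partial\Omega$ (the lateral sides and the top). Write $u=w^{1/m}$ and assume that the solution is regular in the following sense: $u(x,0,\cdot)\in C^2([0,T])$ with $\partial_t^2u$ bounded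 uniformly in $x$; $\partial_x^2 w$ is bounded on $\Omega\times(0,T]$; and, with $\varphi(s)=s^m$, $|\varphi'(u(x,y,t))-\varphi'(u(x,0,t))|\le R\,y^\sigma$ on $\overline\Omega\times[0,T]$ for some constant $R$. **Numerical method.** For positive integers $I,K,J$ with $\Delta x:=2X/I=Y/K$, let $\Delta t=T/J$, $x_i=i\Delta x-X$, $y_k=k\Delta x$, $t_j=j\Delta t$. On each such mesh let $L^D_\sigma$ be a linear operator on grid functions such that * (maximum principle) if $L_\sigma^DZ\ge0$ at all interior nodes ($0<i<I$, $0<k<K$), then $Z$ is nowhere larger than its maximum over the boundary nodes; * (order $a$) $\max|L^D_\sigma v_i^k-L_\sigma v(x_i,y_k)|=O(\Delta x^a)$ as $\Delta x\to0$, the maximum being over interior nodes, for every $v$ in a class of regular functions that contains all $C^\infty$ functions of $(x,y)\in\mathbb R^2$ and contains $w$ (for $v=w$ the bound is uniform in $t\in(0,T]$). Let $(W_j)_i^k$, $0\le j\le J$, solve $L^D_\sigma[(W_j)_i^k]=0$ at the interior nodes, $(W_j)_i^k=0$ if $i\in\{0,I\}$ or $k=K$, and, for $0<i<I$, $(W_0)_i^0=f(x_i)^m$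 and $$(W_j)_i^0=\Big[\nu_\sigma\frac{\Delta t}{\Delta x^\sigma}\big((W_{j-1})_i^1-(W_{j-1})_i^0\big)+[(W_{j-1})_i^0]^{1/m}\Big]^m,\qquad 1\le j\le J.$$ Let $F_J=\max_{i,k}|w(x_i,y_k,T)-(W_J)_i^k|$, and let $C(m,f)=\big[m\,\|f\|_\infty^{m-1}\,\nu_\sigma\big]^{-1}$, where $\|f\|_\infty=\sup_{[-X,X]}f$ (and $C(m,f)=+\infty$ if the bracket is zero). **Corollary (lower order convergence).** Fix $\delta>0$, $D>0$ and suppose that the order of discretization satisfies $a\ge\sigma+\delta$. Then there is a constant $C$, independent of the mesh, such that whenever $$D\,\Delta x^{a-\delta}\le\Delta t\le C(m,f)\,\Delta x^\sigma,$$ we have $F_J\le C\,(\Delta t+\Delta x^{2-\sigma}+\Delta x^{\delta})$, that is, $F_J=O(\Delta t+\Delta x^{2-\sigma}+\Delta x^\delta)$. -/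

import Mathlib

open Set Filter Topology
open scoped ContDiff

noncomputable section

namespace FracPME

/-- `μ_σ = 2^(σ-1) Γ(σ/2) / Γ(1-σ/2)`. -/
def muConst (σ : ℝ) : ℝ :=
  2 ^ (σ - 1) * Real.Gamma (σ / 2) / Real.Gamma (1 - σ / 2)

/-- `ν_σ = σ μ_σ`. -/
def nuConst (σ : ℝ) : ℝ := σ * muConst σ

/-- The extension operator `L_σ v = ∇ · (y^(1-σ) ∇ v)` at the point `(x, y)`. -/
def extOp (σ : ℝ) (v : ℝ → ℝ → ℝ) (x y : ℝ) : ℝ :=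
  deriv (fun s => y ^ (1 - σ) * deriv (fun r => v r y) s) x
    + deriv (fun s => s ^ (1 - σ) * deriv (fun r => v x r) s) y

/-- `∂v/∂y^σ (x, 0) = μ_σ lim_{y → 0+} y^(1-σ) ∂v/∂y (x, y)` exists and equals `d`. -/
def HasSigmaDeriv (σ : ℝ) (v : ℝ → ℝ → ℝ) (x d : ℝ) : Prop :=
  Tendsto (fun y => muConst σ * (y ^ (1 - σ) * deriv (fun r => v x r) y)) (𝓝[>] 0) (𝓝 d)

/-- `w = w(x, y, t)` is a nonnegative classical solution of the extension problem in
`Ω = (-X, X) × (0, Y)`, `0 ≤ t ≤ T`, with initial datum `f`. -/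
structure IsClassicalSolution (σ m X Y T : ℝ) (f : ℝ → ℝ) (w : ℝ → ℝ → ℝ → ℝ) : Prop where
  continuousOn : ContinuousOn (fun p : ℝ × ℝ × ℝ => w p.1 p.2.1 p.2.2)
    (Icc (-X) X ×ˢ Icc 0 Y ×ˢ Icc 0 T)
  nonneg : ∀ x ∈ Icc (-X) X, ∀ y ∈ Icc 0 Y, ∀ t ∈ Icc 0 T, 0 ≤ w x y t
  contDiffOn : ∀ t ∈ Ioc 0 T,
    ContDiffOn ℝ 2 (fun p : ℝ × ℝ => w p.1 p.2 t) (Ioo (-X) X ×ˢ Ioo 0 Y)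
  ext_eq : ∀ x ∈ Ioo (-X) X, ∀ y ∈ Ioo 0 Y, ∀ t ∈ Ioc 0 T,
    extOp σ (fun r s => w r s t) x y = 0
  /-- `∂(w^(1/m))/∂t = ∂w/∂y^σ` on the base; both derivatives exist. -/
  base_eq : ∀ x ∈ Icc (-X) X, ∀ t ∈ Ioc 0 T, ∃ d : ℝ,
    HasSigmaDeriv σ (fun r s => w r s t) x d ∧
    HasDerivWithinAt (fun τ => w x 0 τ ^ (1 / m)) d (Icc 0 T) t
  initial : ∀ x ∈ Icc (-X) X, w x 0 0 = f x ^ m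
  side_zero : ∀ x : ℝ, (x = -X ∨ x = X) → ∀ y ∈ Ioc 0 Y, ∀ t ∈ Icc 0 T, w x y t = 0
  top_zero : ∀ x ∈ Icc (-X) X, ∀ t ∈ Icc 0 T, w x Y t = 0

/-- Regularity of the theoretical solution, with `u = w^(1/m)`: `u` is `C²` in `t` on the base and
`u^m = w` is `C²` in `x`, with bounded second derivatives, and `φ'(u) = m u^(m-1)`, where
`φ(s) = s^m`, differs from its value on the base by at most a multiple of `y^σ`. -/
structure IsRegular (σ m X Y T : ℝ) (w : ℝ → ℝ → ℝ → ℝ) : Prop where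
  time_contDiffOn : ∀ x ∈ Icc (-X) X,
    ContDiffOn ℝ 2 (fun t => w x 0 t ^ (1 / m)) (Icc 0 T)
  time_bound : ∃ B : ℝ, ∀ x ∈ Icc (-X) X, ∀ t ∈ Icc 0 T,
    |iteratedDerivWithin 2 (fun s => w x 0 s ^ (1 / m)) (Icc 0 T) t| ≤ B
  space_bound : ∃ B : ℝ, ∀ x ∈ Ioo (-X) X, ∀ y ∈ Ioo 0 Y, ∀ t ∈ Ioc 0 T,
    |iteratedDeriv 2 (fun s => w s y t) x| ≤ B
  base_bound : ∃ R : ℝ, ∀ x ∈ Icc (-X) X, ∀ y ∈ Icc 0 Y, ∀ t ∈ Icc 0 T,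
    |m * (w x y t ^ (1 / m)) ^ (m - 1) - m * (w x 0 t ^ (1 / m)) ^ (m - 1)| ≤ R * y ^ σ

/-- A uniform mesh of `[-X, X] × [0, Y]` with `I` steps in `x` and `K` steps in `y`,
and the same step length `Δx = Δy` in both directions. -/
structure Mesh (X Y : ℝ) where
  I : ℕ
  K : ℕ
  I_pos : 0 < I
  K_pos : 0 < K
  square : 2 * X / I = Y / K

namespace Mesh

variable {X Y : ℝ}

/-- Functions on the nodes `(i, k)`, `0 ≤ i ≤ I`, `0 ≤ k ≤ K`. -/
abbrev Grid (M : Mesh X Y) : Type := Fin (M.I + 1) → Fin (M.K + 1) → ℝ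

/-- `Δx = 2X / I`. -/
def dx (M : Mesh X Y) : ℝ := 2 * X / M.I

/-- `x_i = i Δx - X`. -/
def xNode (M : Mesh X Y) (i : Fin (M.I + 1)) : ℝ := (i : ℕ) * M.dx - X

/-- `y_k = k Δx`. -/
def yNode (M : Mesh X Y) (k : Fin (M.K + 1)) : ℝ := (k : ℕ) * M.dx

/-- Interior nodes: `0 < i < I` and `0 < k < K`. -/
def Interior (M : Mesh X Y) (i : Fin (M.I + 1)) (k : Fin (M.K + 1)) : Prop :=
  (0 < (i : ℕ) ∧ (i : ℕ) < M.I) ∧ (0 < (k : ℕ) ∧ (k : ℕ) < M.K)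

/-- Values of a function at the nodes. -/
def restrict (M : Mesh X Y) (v : ℝ → ℝ → ℝ) : M.Grid := fun i k => v (M.xNode i) (M.yNode k)

/-- The index `k = 1` (recall `K ≥ 1`). -/
def kOne (M : Mesh X Y) : Fin (M.K + 1) := ⟨1, Nat.succ_lt_succ M.K_pos⟩

end Mesh

/-- A linear discretization `L_σ^D` on every mesh; only the values at interior nodes are used. -/
abbrev Discretization (X Y : ℝ) : Type := (M : Mesh X Y) → (M.Grid →ₗ[ℝ] M.Grid)

/-- Discrete maximum principle: if `L^D Z ≥ 0` at all interior nodes, then `Z` does not exceed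
its maximum over the boundary nodes. -/
def Discretization.MaxPrinciple {X Y : ℝ} (LD : Discretization X Y) : Prop :=
  ∀ (M : Mesh X Y) (Z : M.Grid), (∀ i k, M.Interior i k → 0 ≤ LD M Z i k) →
    ∀ c : ℝ, (∀ i k, ¬ M.Interior i k → Z i k ≤ c) → ∀ i k, Z i k ≤ c

/-- `LD` is a discretization of `L_σ` of order `a` on the class `R` of (time dependent) functions:
`max_{i,k} |L^D v_i^k - L_σ v(x_i, y_k)| = O(Δx^a)` for every `v` in `R`, uniformly in time. -/
def Discretization.HasOrder {X Y : ℝ} (LD : Discretization X Y) (σ T a : ℝ)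
    (R : Set (ℝ → ℝ → ℝ → ℝ)) : Prop :=
  ∀ v ∈ R, ∃ C h₀ : ℝ, 0 < h₀ ∧ ∀ M : Mesh X Y, M.dx ≤ h₀ →
    ∀ i k, M.Interior i k → ∀ t ∈ Ioc 0 T,
      |LD M (M.restrict fun x y => v x y t) i k
        - extOp σ (fun x y => v x y t) (M.xNode i) (M.yNode k)| ≤ C * M.dx ^ a

/-- `W j` is the solution of the numerical method at time `t_j = j Δt`, `Δt = T / J`,
for `j = 0, …, J`. -/
structure IsNumericalSolution {X Y : ℝ} (LD : Discretization X Y) (σ m T : ℝ) (f : ℝ → ℝ)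
    (M : Mesh X Y) (J : ℕ) (W : ℕ → M.Grid) : Prop where
  interior_eq : ∀ j ≤ J, ∀ i k, M.Interior i k → LD M (W j) i k = 0
  initial : ∀ i : Fin (M.I + 1), 0 < (i : ℕ) → (i : ℕ) < M.I → W 0 i 0 = f (M.xNode i) ^ m
  step : ∀ j < J, ∀ i : Fin (M.I + 1), 0 < (i : ℕ) → (i : ℕ) < M.I →
    W (j + 1) i 0 =
      (nuConst σ * ((T / J) / M.dx ^ σ) * (W j i M.kOne - W j i 0) + W j i 0 ^ (1 / m)) ^ m
  lateral : ∀ j ≤ J, ∀ (i : Fin (M.I + 1)) (k : Fin (M.K + 1)),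
    ((i : ℕ) = 0 ∨ (i : ℕ) = M.I ∨ (k : ℕ) = M.K) → W j i k = 0

/-- `F_j = max_{i,k} |w(x_i, y_k, t_j) - (W_j)_i^k|`. -/
def errorF {X Y : ℝ} (T : ℝ) (w : ℝ → ℝ → ℝ → ℝ) (M : Mesh X Y) (J : ℕ) (W : ℕ → M.Grid)
    (j : ℕ) : ℝ :=
  ⨆ p : Fin (M.I + 1) × Fin (M.K + 1),
    |w (M.xNode p.1) (M.yNode p.2) (j * (T / J)) - W j p.1 p.2|

/-- The CFL condition `Δt ≤ C(m,f) Δx^σ`, `C(m,f) = 1 / (m ‖f‖_∞^(m-1) ν_σ)`, with the denominator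
multiplied out (so that it is no restriction when `f = 0` and `m > 1`). -/
def CFL (σ m X : ℝ) (f : ℝ → ℝ) (dt dx : ℝ) : Prop :=
  m * sSup (f '' Icc (-X) X) ^ (m - 1) * nuConst σ * dt ≤ dx ^ σ

end FracPME

end

namespace FracPME

/-! The argument is consistency plus stability, with the error measured in `w` rather than in `u =
w^(1/m)`, since the discrete maximum principle acts on `w`.

Consistency. As `L_σ w = 0` and `∂_x² w` is bounded, the flux `y^(1-σ) ∂_y w` has `y`-derivative
`O(y^(1-σ))`. Integrating twice shows that the difference quotient of the scheme approximates the
flux up to `O(Δx^(2-σ))` (`flux_expansion`); with Taylor's formula in time, one step has truncation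
error `O(Δt (Δt + Δx^(2-σ)))` (`IsRegular.exists_truncation`). Inside the domain, the discrete
maximum principle and a barrier bound the error by its maximum on the base plus `O(Δx^a)`
(`exists_error_le_base`). That residual enters a step multiplied by `ν_σ Δt/Δx^σ`, hence contributes
`O(Δt Δx^δ)` because `a ≥ σ + δ`.

Stability. Under the CFL condition `s ↦ s - λ s^m` is increasing on `[0, S]`, with `S = ‖f‖_∞`. So a
step started from `w₀ ± E` in place of `w₀` moves `u` by at most `(w₀ ± E)^(1/m) - u`, up to small
terms. To return to powers this shift must be applied at the new value `v` of `u`. If `v ≤ u`,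
convexity of `s^m` gives back at most `E`; in general a factor `γ^m` appears as soon as `v ≤ γ u`.
The relative growth bound `IsRegular.exists_growth`, where the hypothesis on `φ'(u)` enters,
supplies `γ = exp(C Δt)`, also where `u` degenerates. The result is `explicit_step_error`; a
discrete Grönwall induction over `T/Δt` steps (`exists_base_error`) concludes. -/

lemma muConst_pos {σ : ℝ} (hσ : σ ∈ Ioo (0 : ℝ) 2) : 0 < muConst σ := by
  unfold muConst
  have h1 : 0 < Real.Gamma (σ / 2) := Real.Gamma_pos_of_pos (by linarith [hσ.1])
  have h2 : 0 < Real.Gamma (1 - σ / 2) := Real.Gamma_pos_of_pos (by linarith [hσ.2])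
  positivity

lemma nuConst_pos {σ : ℝ} (hσ : σ ∈ Ioo (0 : ℝ) 2) : 0 < nuConst σ :=
  mul_pos hσ.1 (muConst_pos hσ)

/-! ### The maximum principle for the extension operator -/

/-- Were the second derivative positive, the second derivative test would make the point a local
minimum as well, so the function would be locally constant and the second derivative zero. -/
lemma deriv_deriv_nonpos_of_isLocalMax {g : ℝ → ℝ} {x : ℝ} (hmax : IsLocalMax g x)
    (hc : ContinuousAt g x) : deriv (deriv g) x ≤ 0 := by
  by_contra! hpos
  have hmin := isLocalMin_of_deriv_deriv_pos hpos hmax.deriv_eq_zero hc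
  have hev : g =ᶠ[𝓝 x] fun _ => g x := by
    filter_upwards [hmax, hmin] with y h1 h2 using le_antisymm h1 h2
  have : deriv (deriv g) x = 0 := by
    rw [hev.deriv.deriv_eq]
    simp
  linarith

lemma contDiffOn_slice_fst {X Y y : ℝ} {v : ℝ → ℝ → ℝ}
    (h : ContDiffOn ℝ 2 (fun p : ℝ × ℝ => v p.1 p.2) (Ioo (-X) X ×ˢ Ioo 0 Y))
    (hy : y ∈ Ioo 0 Y) : ContDiffOn ℝ 2 (fun s => v s y) (Ioo (-X) X) :=
  h.comp (f := fun s : ℝ => (s, y)) (by fun_prop) fun _ hs => ⟨hs, hy⟩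

lemma contDiffOn_slice_snd {X Y x : ℝ} {v : ℝ → ℝ → ℝ}
    (h : ContDiffOn ℝ 2 (fun p : ℝ × ℝ => v p.1 p.2) (Ioo (-X) X ×ˢ Ioo 0 Y))
    (hx : x ∈ Ioo (-X) X) : ContDiffOn ℝ 2 (fun s => v x s) (Ioo 0 Y) :=
  h.comp (f := fun s : ℝ => (x, s)) (by fun_prop) fun _ hs => ⟨hx, hs⟩

lemma differentiableAt_deriv_of_contDiffOn_two {g : ℝ → ℝ} {a b y : ℝ}
    (h : ContDiffOn ℝ 2 g (Ioo a b)) (hy : y ∈ Ioo a b) :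
    DifferentiableAt ℝ g y ∧ DifferentiableAt ℝ (deriv g) y := by
  have hn : Ioo a b ∈ 𝓝 y := isOpen_Ioo.mem_nhds hy
  have h1 : ContDiffOn ℝ 1 (deriv g) (Ioo a b) :=
    h.deriv_of_isOpen isOpen_Ioo (by norm_num)
  exact ⟨(h.differentiableOn (by norm_num)).differentiableAt hn,
    (h1.differentiableOn (by norm_num)).differentiableAt hn⟩

/-- A solution of `L_σ v = 0` does not exceed its boundary values. -/
theorem le_of_boundary_le {σ X Y c : ℝ} {v : ℝ → ℝ → ℝ}
    (hc : ContinuousOn (fun p : ℝ × ℝ => v p.1 p.2) (Icc (-X) X ×ˢ Icc 0 Y))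
    (h2 : ContDiffOn ℝ 2 (fun p : ℝ × ℝ => v p.1 p.2) (Ioo (-X) X ×ˢ Ioo 0 Y))
    (heq : ∀ x ∈ Ioo (-X) X, ∀ y ∈ Ioo 0 Y, extOp σ v x y = 0)
    (hb : ∀ x ∈ Icc (-X) X, ∀ y ∈ Icc 0 Y, (x = -X ∨ x = X ∨ y = 0 ∨ y = Y) → v x y ≤ c) :
    ∀ x ∈ Icc (-X) X, ∀ y ∈ Icc 0 Y, v x y ≤ c := by
  intro x hx y hy
  -- The perturbation `ε x²` makes the maximum strict in `x` but leaves the `y`-derivatives alone: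
  -- at an interior maximum `∂_y v = 0`, which kills the singular first-order term of `L_σ`, while
  -- `∂_x² v ≤ -2ε` and `∂_y² v ≤ 0`.
  have key : ∀ ε > 0, v x y ≤ c + ε * X ^ 2 := by
    intro ε hε
    have hcg : ContinuousOn (fun p : ℝ × ℝ => v p.1 p.2 + ε * p.1 ^ 2)
        (Icc (-X) X ×ˢ Icc 0 Y) := hc.add (by fun_prop)
    obtain ⟨⟨x0, y0⟩, ⟨hx0, hy0⟩, hmax⟩ :=
      (isCompact_Icc.prod isCompact_Icc).exists_isMaxOn ⟨(x, y), hx, hy⟩ hcg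
    simp only at hx0 hy0
    have hle : v x y + ε * x ^ 2 ≤ v x0 y0 + ε * x0 ^ 2 := hmax (show (x, y) ∈ _ from ⟨hx, hy⟩)
    have hx2 : x0 ^ 2 ≤ X ^ 2 := sq_le_sq' hx0.1 hx0.2
    by_cases hbd : x0 = -X ∨ x0 = X ∨ y0 = 0 ∨ y0 = Y
    · have := hb x0 hx0 y0 hy0 hbd
      nlinarith [sq_nonneg x]
    · exfalso
      push Not at hbd
      obtain ⟨n1, n2, n3, n4⟩ := hbd
      have hx0' : x0 ∈ Ioo (-X) X := ⟨lt_of_le_of_ne hx0.1 (Ne.symm n1), lt_of_le_of_ne hx0.2 n2⟩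
      have hy0' : y0 ∈ Ioo 0 Y := ⟨lt_of_le_of_ne hy0.1 (Ne.symm n3), lt_of_le_of_ne hy0.2 n4⟩
      have hslx := contDiffOn_slice_fst h2 hy0'
      have hsly := contDiffOn_slice_snd h2 hx0'
      obtain ⟨dx1, dx2⟩ := differentiableAt_deriv_of_contDiffOn_two hslx hx0'
      obtain ⟨dy1, dy2⟩ := differentiableAt_deriv_of_contDiffOn_two hsly hy0'
      have hxx : deriv (deriv fun s => v s y0) x0 + 2 * ε ≤ 0 := by
        have hm : IsLocalMax (fun s => v s y0 + ε * s ^ 2) x0 := by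
          filter_upwards [isOpen_Ioo.mem_nhds hx0'] with s hs
          exact hmax (show (s, y0) ∈ _ from ⟨Ioo_subset_Icc_self hs, hy0⟩)
        have hd : deriv (fun s => v s y0 + ε * s ^ 2)
            =ᶠ[𝓝 x0] fun s => deriv (fun s => v s y0) s + 2 * ε * s := by
          filter_upwards [isOpen_Ioo.mem_nhds hx0'] with s hs
          have := (differentiableAt_deriv_of_contDiffOn_two hslx hs).1
          have h3 := this.hasDerivAt.add (((hasDerivAt_id s).pow 2).const_mul ε)
          refine HasDerivAt.deriv (h3.congr_deriv ?_)
          simp; ring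
        have h4 := deriv_deriv_nonpos_of_isLocalMax hm (by
          exact dx1.continuousAt.add (by fun_prop))
        rw [hd.deriv_eq] at h4
        have h5 := dx2.hasDerivAt.add ((hasDerivAt_id x0).const_mul (2 * ε))
        have h6 : deriv (fun s => deriv (fun s => v s y0) s + 2 * ε * s) x0
          = deriv (deriv fun s => v s y0) x0 + 2 * ε * 1 := h5.deriv
        linarith
      have hmy : IsLocalMax (fun s => v x0 s) y0 := by
        filter_upwards [isOpen_Ioo.mem_nhds hy0'] with s hs
        have : v x0 s + ε * x0 ^ 2 ≤ v x0 y0 + ε * x0 ^ 2 :=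
          hmax (show (x0, s) ∈ _ from ⟨hx0, Ioo_subset_Icc_self hs⟩)
        linarith
      have hyy := deriv_deriv_nonpos_of_isLocalMax hmy dy1.continuousAt
      have hy00 := hmy.deriv_eq_zero
      have hpow : 0 < y0 ^ (1 - σ) := Real.rpow_pos_of_pos hy0'.1 _
      have e := heq x0 hx0' y0 hy0'
      unfold extOp at e
      have e1 : deriv (fun s => y0 ^ (1 - σ) * deriv (fun r => v r y0) s) x0
          = y0 ^ (1 - σ) * deriv (deriv fun s => v s y0) x0 := by
        rw [deriv_const_mul_field]
      have e2 : deriv (fun s => s ^ (1 - σ) * deriv (fun r => v x0 r) s) y0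
          = y0 ^ (1 - σ) * deriv (deriv fun s => v x0 s) y0 := by
        have hp : HasDerivAt (fun s : ℝ => s ^ (1 - σ)) ((1 - σ) * y0 ^ (1 - σ - 1)) y0 :=
          Real.hasDerivAt_rpow_const (Or.inl hy0'.1.ne')
        have := (hp.mul dy2.hasDerivAt).deriv
        rw [hy00, mul_zero, zero_add] at this
        exact this
      rw [e1, e2, ← mul_add] at e
      have : y0 ^ (1 - σ) * (deriv (deriv fun s => v s y0) x0 + deriv (deriv fun s => v x0 s) y0)
        < 0 := mul_neg_of_pos_of_neg hpow (by linarith)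
      linarith
  refine le_of_forall_pos_le_add fun η hη => ?_
  have hX : 0 < X ^ 2 + 1 := by positivity
  refine (key (η / (X ^ 2 + 1)) (by positivity)).trans ?_
  have : η / (X ^ 2 + 1) * X ^ 2 ≤ η := by
    rw [div_mul_eq_mul_div, div_le_iff₀ hX]
    nlinarith
  linarith

/-! ### A priori bounds for the solution -/

section Solution

variable {σ m X Y T : ℝ} {f : ℝ → ℝ} {w : ℝ → ℝ → ℝ → ℝ}

lemma IsClassicalSolution.continuousOn_space (hw : IsClassicalSolution σ m X Y T f w) {t : ℝ}
    (ht : t ∈ Icc 0 T) :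
    ContinuousOn (fun p : ℝ × ℝ => w p.1 p.2 t) (Icc (-X) X ×ˢ Icc 0 Y) :=
  hw.continuousOn.comp (f := fun p : ℝ × ℝ => (p.1, p.2, t)) (by fun_prop)
    fun _ hp => ⟨hp.1, hp.2, ht⟩

lemma IsClassicalSolution.continuousOn_y (hw : IsClassicalSolution σ m X Y T f w) {x t : ℝ}
    (hx : x ∈ Icc (-X) X) (ht : t ∈ Icc 0 T) : ContinuousOn (fun y => w x y t) (Icc 0 Y) :=
  hw.continuousOn.comp (f := fun y : ℝ => (x, y, t)) (by fun_prop) fun _ hp => ⟨hx, hp, ht⟩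

lemma IsClassicalSolution.continuousOn_t (hw : IsClassicalSolution σ m X Y T f w) {x y : ℝ}
    (hx : x ∈ Icc (-X) X) (hy : y ∈ Icc 0 Y) : ContinuousOn (fun t => w x y t) (Icc 0 T) :=
  hw.continuousOn.comp (f := fun t : ℝ => (x, y, t)) (by fun_prop) fun _ hp => ⟨hx, hy, hp⟩

/-- The lateral condition is imposed only for `y > 0`; the corners `y = 0` follow by continuity. -/
lemma IsClassicalSolution.lateral_zero (hw : IsClassicalSolution σ m X Y T f w) (hX : 0 < X)
    (hY : 0 < Y) {x y t : ℝ} (hx : x = -X ∨ x = X) (hy : y ∈ Icc 0 Y) (ht : t ∈ Icc 0 T) :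
    w x y t = 0 := by
  rcases hy.1.eq_or_lt with h | h
  · subst h
    have hxm : x ∈ Icc (-X) X := by
      rcases hx with rfl | rfl <;> constructor <;> linarith
    have h1 : Tendsto (fun y => w x y t) (𝓝[Ioc 0 Y] 0) (𝓝 (w x 0 t)) :=
      ((hw.continuousOn_y hxm ht) 0 ⟨le_rfl, hY.le⟩).mono_left (nhdsWithin_mono _ Ioc_subset_Icc_self)
    have h2 : Tendsto (fun y => w x y t) (𝓝[Ioc 0 Y] 0) (𝓝 0) := by
      refine tendsto_const_nhds.congr' ?_
      filter_upwards [self_mem_nhdsWithin] with y hy using (hw.side_zero x hx y hy t ht).symm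
    have : (𝓝[Ioc 0 Y] (0 : ℝ)).NeBot := left_nhdsWithin_Ioc_neBot hY
    exact tendsto_nhds_unique h1 h2
  · exact hw.side_zero x hx y ⟨h, hy.2⟩ t ht

lemma IsClassicalSolution.le_of_base_le (hw : IsClassicalSolution σ m X Y T f w) (hX : 0 < X)
    (hY : 0 < Y) {t c : ℝ} (ht : t ∈ Ioc 0 T) (hc : 0 ≤ c)
    (hb : ∀ x ∈ Icc (-X) X, w x 0 t ≤ c) : ∀ x ∈ Icc (-X) X, ∀ y ∈ Icc 0 Y, w x y t ≤ c := by
  have ht' := Ioc_subset_Icc_self ht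
  refine le_of_boundary_le (σ := σ) (v := fun x y => w x y t) (hw.continuousOn_space ht')
    (hw.contDiffOn t ht) (fun x hx y hy => hw.ext_eq x hx y hy t ht) ?_
  rintro x hx y hy (h | h | h | h)
  · rw [hw.lateral_zero hX hY (Or.inl h) hy ht']; exact hc
  · rw [hw.lateral_zero hX hY (Or.inr h) hy ht']; exact hc
  · rw [h]; exact hb x hx
  · rw [h, hw.top_zero x hx t ht']; exact hc

/-- A positive limit of the flux would make `v` strictly increasing in `y` near the base. -/
lemma HasSigmaDeriv.nonpos_of_forall_le {v : ℝ → ℝ → ℝ} {x d : ℝ} (hσ : σ ∈ Ioo (0 : ℝ) 2)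
    (hY : 0 < Y) (h : HasSigmaDeriv σ v x d) (hc : ContinuousOn (fun y => v x y) (Icc 0 Y))
    (hle : ∀ y ∈ Icc 0 Y, v x y ≤ v x 0) : d ≤ 0 := by
  by_contra! hd
  have hev : ∀ᶠ y in 𝓝[>] (0 : ℝ), 0 < muConst σ * (y ^ (1 - σ) * deriv (fun r => v x r) y) :=
    h.eventually (lt_mem_nhds hd)
  obtain ⟨b, hb, hbs⟩ := mem_nhdsGT_iff_exists_Ioo_subset.1 hev
  have hb0 : (0 : ℝ) < b := hb
  have hη : 0 < min b Y := lt_min hb0 hY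
  have hmono : StrictMonoOn (fun y => v x y) (Icc 0 (min b Y)) := by
    refine strictMonoOn_of_deriv_pos (convex_Icc _ _)
      (hc.mono (Icc_subset_Icc_right (min_le_right _ _))) fun y hy => ?_
    rw [interior_Icc] at hy
    have h1 : 0 < muConst σ * (y ^ (1 - σ) * deriv (fun r => v x r) y) :=
      hbs ⟨hy.1, hy.2.trans_le (min_le_left _ _)⟩
    exact (pos_iff_pos_of_mul_pos ((pos_iff_pos_of_mul_pos h1).1 (muConst_pos hσ))).1
      (Real.rpow_pos_of_pos hy.1 _)
  have h1 : v x 0 < v x (min b Y) :=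
    hmono ⟨le_rfl, hη.le⟩ ⟨hη.le, le_rfl⟩ hη
  exact absurd (hle _ ⟨hη.le, min_le_right _ _⟩) (not_le.2 h1)

lemma IsClassicalSolution.initial_eq (hw : IsClassicalSolution σ m X Y T f w) (hm : 1 ≤ m)
    (hf : ∀ x ∈ Icc (-X) X, 0 ≤ f x) {x : ℝ} (hx : x ∈ Icc (-X) X) :
    w x 0 0 ^ (1 / m) = f x := by
  rw [hw.initial x hx, ← Real.rpow_mul (hf x hx), mul_one_div_cancel (by linarith), Real.rpow_one]

/-- No continuity or boundedness of `f` is assumed: both come from `f = w(·,0,0)^(1/m)`, so that the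
supremum is a genuine one. -/
lemma IsClassicalSolution.le_sSup (hw : IsClassicalSolution σ m X Y T f w) (hm : 1 ≤ m)
    (hY : 0 < Y) (hT : 0 < T)
    (hf : ∀ x ∈ Icc (-X) X, 0 ≤ f x) {x : ℝ} (hx : x ∈ Icc (-X) X) :
    f x ≤ sSup (f '' Icc (-X) X) := by
  have hc : ContinuousOn (fun x => w x 0 0 ^ (1 / m)) (Icc (-X) X) := by
    refine ContinuousOn.rpow_const ?_ fun _ _ => Or.inr (by positivity)
    exact hw.continuousOn.comp (f := fun x : ℝ => (x, 0, 0)) (by fun_prop)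
      fun _ hp => ⟨hp, ⟨le_rfl, hY.le⟩, ⟨le_rfl, hT.le⟩⟩
  have himg : f '' Icc (-X) X = (fun x => w x 0 0 ^ (1 / m)) '' Icc (-X) X :=
    image_congr fun y hy => (hw.initial_eq hm hf hy).symm
  refine _root_.le_csSup ?_ (mem_image_of_mem f hx)
  rw [himg]
  exact (isCompact_Icc.image_of_continuousOn hc).bddAbove

/-- On the base the solution stays below the supremum of the initial datum. -/
theorem IsClassicalSolution.base_le (hw : IsClassicalSolution σ m X Y T f w)
    (hσ : σ ∈ Ioo (0 : ℝ) 2) (hm : 1 ≤ m) (hX : 0 < X) (hY : 0 < Y) (hT : 0 < T)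
    (hf : ∀ x ∈ Icc (-X) X, 0 ≤ f x) {x t : ℝ} (hx : x ∈ Icc (-X) X) (ht : t ∈ Icc 0 T) :
    w x 0 t ^ (1 / m) ≤ sSup (f '' Icc (-X) X) := by
  have h0Y : (0 : ℝ) ∈ Icc 0 Y := ⟨le_rfl, hY.le⟩
  have hm0 : 0 < 1 / m := by positivity
  -- At a maximum of `u - ε t` with `t₀ > 0` the time derivative of `u` is at least `ε`; but `x₀`
  -- then maximizes `w(·,·,t₀)` over the whole closed rectangle, so the flux there, which equals
  -- that derivative, is nonpositive.
  have key : ∀ ε > 0, w x 0 t ^ (1 / m) ≤ sSup (f '' Icc (-X) X) + ε * T := by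
    intro ε hε
    have hcg : ContinuousOn (fun p : ℝ × ℝ => w p.1 0 p.2 ^ (1 / m) - ε * p.2)
        (Icc (-X) X ×ˢ Icc 0 T) := by
      refine ContinuousOn.sub (ContinuousOn.rpow_const ?_ fun _ _ => Or.inr hm0.le) (by fun_prop)
      exact hw.continuousOn.comp (f := fun p : ℝ × ℝ => (p.1, 0, p.2)) (by fun_prop)
        fun _ hp => ⟨hp.1, h0Y, hp.2⟩
    obtain ⟨⟨x0, t0⟩, ⟨hx0, ht0⟩, hmax⟩ :=
      (isCompact_Icc.prod isCompact_Icc).exists_isMaxOn ⟨(x, t), hx, ht⟩ hcg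
    simp only at hx0 ht0
    have hle : w x 0 t ^ (1 / m) - ε * t ≤ w x0 0 t0 ^ (1 / m) - ε * t0 :=
      hmax (show (x, t) ∈ _ from ⟨hx, ht⟩)
    rcases ht0.1.eq_or_lt with h | h
    · subst h
      rw [hw.initial_eq hm hf hx0] at hle
      have := hw.le_sSup hm hY hT hf hx0
      nlinarith [ht.2]
    · exfalso
      obtain ⟨d, hd1, hd2⟩ := hw.base_eq x0 hx0 t0 ⟨h, ht0.2⟩
      have hbase : ∀ r ∈ Icc (-X) X, w r 0 t0 ≤ w x0 0 t0 := by
        intro r hr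
        have h1 : w r 0 t0 ^ (1 / m) - ε * t0 ≤ w x0 0 t0 ^ (1 / m) - ε * t0 :=
          hmax (show (r, t0) ∈ _ from ⟨hr, ht0⟩)
        exact (Real.rpow_le_rpow_iff (hw.nonneg r hr 0 h0Y t0 ht0)
          (hw.nonneg x0 hx0 0 h0Y t0 ht0) hm0).1 (by linarith)
      have hall := hw.le_of_base_le hX hY ⟨h, ht0.2⟩ (hw.nonneg x0 hx0 0 h0Y t0 ht0) hbase
      have hd0 : d ≤ 0 := hd1.nonpos_of_forall_le hσ hY (hw.continuousOn_y hx0 ht0)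
        fun y hy => hall x0 hx0 y hy
      -- Only times before `t₀` are used, since `t₀ = T` is possible.
      have hd3 := hd2.mono (s := Ioo 0 t0)
        (fun s hs => ⟨hs.1.le, hs.2.le.trans ht0.2⟩)
      rw [hasDerivWithinAt_iff_tendsto_slope' (by simp)] at hd3
      have : (𝓝[Ioo 0 t0] t0).NeBot := right_nhdsWithin_Ioo_neBot h
      have hε' : ε ≤ d := by
        refine ge_of_tendsto hd3 ?_
        filter_upwards [self_mem_nhdsWithin] with s hs
        have h1 : w x0 0 s ^ (1 / m) - ε * s ≤ w x0 0 t0 ^ (1 / m) - ε * t0 :=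
          hmax (show (x0, s) ∈ _ from ⟨hx0, hs.1.le, hs.2.le.trans ht0.2⟩)
        rw [slope_comm, slope_def_field, le_div_iff₀ (by linarith [hs.2])]
        linarith
      linarith
  refine le_of_forall_pos_le_add fun η hη => ?_
  have := key (η / T) (by positivity)
  rwa [div_mul_cancel₀ _ hT.ne'] at this

end Solution

/-! ### Expansion of the solution near the base -/

/-- Two integrations, phrased as monotonicity: the flux plus `B/(2-σ) y^(2-σ)` increases from its
limit `A`; multiplying by `y^(σ-1)` bounds `v'` below by `A y^(σ-1) - B/(2-σ) y`, which is
integrated again. The two-sided version applies this to `v` and `-v`. -/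
lemma flux_expansion_lower {σ Y A B : ℝ} (hσ : σ ∈ Ioo (0 : ℝ) 2) {v : ℝ → ℝ}
    (hc : ContinuousOn v (Icc 0 Y)) (hd : ∀ y ∈ Ioo 0 Y, DifferentiableAt ℝ v y)
    (hφ : ∀ y ∈ Ioo 0 Y, DifferentiableAt ℝ (fun s => s ^ (1 - σ) * deriv v s) y)
    (hb : ∀ y ∈ Ioo 0 Y, -(B * y ^ (1 - σ)) ≤ deriv (fun s => s ^ (1 - σ) * deriv v s) y)
    (hA : Tendsto (fun s => s ^ (1 - σ) * deriv v s) (𝓝[>] 0) (𝓝 A)) {h : ℝ} (hh : h ∈ Ioc 0 Y) :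
    A / σ * h ^ σ - (v h - v 0) ≤ B / (2 * (2 - σ)) * h ^ 2 := by
  obtain ⟨hσ0, hσ2⟩ := hσ
  have h2σ : 0 < 2 - σ := by linarith
  have hpd : ∀ (r : ℝ) {y : ℝ}, 0 < y → HasDerivAt (fun s : ℝ => s ^ r) (r * y ^ (r - 1)) y :=
    fun r y hy => Real.hasDerivAt_rpow_const (Or.inl hy.ne')
  have hψd : ∀ y ∈ Ioo 0 Y, HasDerivAt
      (fun s => s ^ (1 - σ) * deriv v s + B / (2 - σ) * s ^ (2 - σ))
      (deriv (fun s => s ^ (1 - σ) * deriv v s) y + B * y ^ (1 - σ)) y := by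
    intro y hy
    have h1 := (hφ y hy).hasDerivAt.add ((hpd (2 - σ) hy.1).const_mul (B / (2 - σ)))
    refine h1.congr_deriv ?_
    rw [show 2 - σ - 1 = 1 - σ by ring]
    field_simp
  have hψm : MonotoneOn (fun s => s ^ (1 - σ) * deriv v s + B / (2 - σ) * s ^ (2 - σ))
      (Ioo 0 Y) := by
    refine monotoneOn_of_deriv_nonneg (convex_Ioo _ _)
      (fun y hy => (hψd y hy).continuousAt.continuousWithinAt) ?_ ?_ <;> rw [interior_Ioo]
    · exact fun y hy => (hψd y hy).differentiableAt.differentiableWithinAt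
    · intro y hy
      rw [(hψd y hy).deriv]
      linarith [hb y hy]
  have hψt : Tendsto (fun s => s ^ (1 - σ) * deriv v s + B / (2 - σ) * s ^ (2 - σ))
      (𝓝[>] 0) (𝓝 A) := by
    have h1 : Tendsto (fun s : ℝ => s ^ (2 - σ)) (𝓝[>] 0) (𝓝 0) := by
      have := (Real.continuousAt_rpow_const 0 (2 - σ) (Or.inr h2σ.le)).tendsto
      rw [Real.zero_rpow h2σ.ne'] at this
      exact this.mono_left nhdsWithin_le_nhds
    simpa using hA.add (h1.const_mul (B / (2 - σ)))
  have hge : ∀ y ∈ Ioo 0 Y, A ≤ y ^ (1 - σ) * deriv v y + B / (2 - σ) * y ^ (2 - σ) := by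
    intro y hy
    refine le_of_tendsto hψt ?_
    filter_upwards [Ioo_mem_nhdsGT hy.1] with s hs
    exact hψm ⟨hs.1, hs.2.trans hy.2⟩ hy hs.2.le
  have hgd : ∀ y ∈ Ioo 0 Y, HasDerivAt
      (fun s => v s - A / σ * s ^ σ + B / (2 * (2 - σ)) * s ^ 2)
      (deriv v y - A * y ^ (σ - 1) + B / (2 - σ) * y) y := by
    intro y hy
    have h1 := ((hd y hy).hasDerivAt.sub ((hpd σ hy.1).const_mul (A / σ))).add
      (((hasDerivAt_id y).pow 2).const_mul (B / (2 * (2 - σ))))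
    refine h1.congr_deriv ?_
    simp only [Nat.cast_ofNat, id, Nat.add_one_sub_one, pow_one, mul_one]
    field_simp
  have hgm : MonotoneOn (fun s => v s - A / σ * s ^ σ + B / (2 * (2 - σ)) * s ^ 2)
      (Icc 0 Y) := by
    refine monotoneOn_of_deriv_nonneg (convex_Icc _ _) ?_ ?_ ?_
    · refine (hc.sub (continuousOn_const.mul ?_)).add (by fun_prop)
      exact fun y _ => (Real.continuousAt_rpow_const y σ (Or.inr hσ0.le)).continuousWithinAt
    · rw [interior_Icc]
      exact fun y hy => (hgd y hy).differentiableAt.differentiableWithinAt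
    · rw [interior_Icc]
      intro y hy
      rw [(hgd y hy).deriv]
      have h1 := mul_le_mul_of_nonneg_left (hge y hy) (Real.rpow_pos_of_pos hy.1 (σ - 1)).le
      have e1 : y ^ (σ - 1) * y ^ (1 - σ) = 1 := by
        rw [← Real.rpow_add hy.1]; simp
      have e2 : y ^ (σ - 1) * y ^ (2 - σ) = y := by
        rw [← Real.rpow_add hy.1, show σ - 1 + (2 - σ) = 1 by ring, Real.rpow_one]
      have e3 : y ^ (σ - 1) * (y ^ (1 - σ) * deriv v y + B / (2 - σ) * y ^ (2 - σ))
          = deriv v y + B / (2 - σ) * y := by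
        calc _ = (y ^ (σ - 1) * y ^ (1 - σ)) * deriv v y
              + B / (2 - σ) * (y ^ (σ - 1) * y ^ (2 - σ)) := by ring
          _ = _ := by rw [e1, e2, one_mul]
      rw [e3] at h1
      linarith
  have := hgm ⟨le_rfl, hh.1.le.trans hh.2⟩ ⟨hh.1.le, hh.2⟩ hh.1.le
  simp only [Real.zero_rpow hσ0.ne'] at this
  linarith

/-- If the flux `y^(1-σ) v'` has limit `A` at `0` and derivative `O(y^(1-σ))`, then
`v(h) = v(0) + (A/σ) h^σ + O(h²)`. -/
theorem flux_expansion {σ Y A B : ℝ} (hσ : σ ∈ Ioo (0 : ℝ) 2) {v : ℝ → ℝ}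
    (hc : ContinuousOn v (Icc 0 Y)) (hd : ∀ y ∈ Ioo 0 Y, DifferentiableAt ℝ v y)
    (hφ : ∀ y ∈ Ioo 0 Y, DifferentiableAt ℝ (fun s => s ^ (1 - σ) * deriv v s) y)
    (hb : ∀ y ∈ Ioo 0 Y, |deriv (fun s => s ^ (1 - σ) * deriv v s) y| ≤ B * y ^ (1 - σ))
    (hA : Tendsto (fun s => s ^ (1 - σ) * deriv v s) (𝓝[>] 0) (𝓝 A)) {h : ℝ} (hh : h ∈ Ioc 0 Y) :
    |v h - v 0 - A / σ * h ^ σ| ≤ B / (2 * (2 - σ)) * h ^ 2 := by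
  have h1 := flux_expansion_lower hσ hc hd hφ (fun y hy => (abs_le.1 (hb y hy)).1) hA hh
  have e : (fun s => s ^ (1 - σ) * deriv (fun y => -v y) s)
      = fun s => -(s ^ (1 - σ) * deriv v s) := by
    funext s
    rw [deriv.fun_neg, mul_neg]
  have h2 := flux_expansion_lower (A := -A) (B := B) (v := fun y => -v y) hσ hc.neg
    (fun y hy => (hd y hy).neg) (by rw [e]; exact fun y hy => (hφ y hy).neg)
    (by
      rw [e]
      intro y hy
      rw [deriv.fun_neg]
      linarith [(abs_le.1 (hb y hy)).2]) (by rw [e]; exact hA.neg) hh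
  rw [abs_le]
  constructor
  · linarith
  · have : -A / σ * h ^ σ = -(A / σ * h ^ σ) := by ring
    linarith

section Solution

variable {σ m X Y T : ℝ} {f : ℝ → ℝ} {w : ℝ → ℝ → ℝ → ℝ}

/-- The equation trades the `y`-derivative of the flux for `-y^(1-σ) ∂_x² w`, which is the bound
`flux_expansion` needs; dividing its `h²` by `h^σ` leaves the order `2-σ`. -/
lemma IsClassicalSolution.sigmaDeriv_expansion (hw : IsClassicalSolution σ m X Y T f w)
    (hσ : σ ∈ Ioo (0 : ℝ) 2) {B : ℝ}
    (hB : ∀ x ∈ Ioo (-X) X, ∀ y ∈ Ioo 0 Y, ∀ t ∈ Ioc 0 T,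
      |iteratedDeriv 2 (fun s => w s y t) x| ≤ B)
    {x t d h : ℝ} (hx : x ∈ Ioo (-X) X) (ht : t ∈ Ioc 0 T)
    (hd : HasSigmaDeriv σ (fun r s => w r s t) x d) (hh : h ∈ Ioc 0 Y) :
    |d - nuConst σ / h ^ σ * (w x h t - w x 0 t)|
      ≤ nuConst σ * (B / (2 * (2 - σ))) * h ^ (2 - σ) := by
  have hμ := muConst_pos hσ
  have hν := nuConst_pos hσ
  have hsl := contDiffOn_slice_snd (v := fun r s => w r s t) (hw.contDiffOn t ht) hx
  have hφ : ∀ y ∈ Ioo 0 Y,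
      DifferentiableAt ℝ (fun s => s ^ (1 - σ) * deriv (fun r => w x r t) s) y := fun y hy =>
    (Real.hasDerivAt_rpow_const (Or.inl hy.1.ne')).differentiableAt.mul
      (differentiableAt_deriv_of_contDiffOn_two hsl hy).2
  have hb : ∀ y ∈ Ioo 0 Y, |deriv (fun s => s ^ (1 - σ) * deriv (fun r => w x r t) s) y|
      ≤ B * y ^ (1 - σ) := by
    intro y hy
    have e := hw.ext_eq x hx y hy t ht
    unfold extOp at e
    rw [deriv_const_mul_field] at e
    have h1 := hB x hx y hy t ht
    rw [iteratedDeriv_succ, iteratedDeriv_one] at h1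
    have hp := Real.rpow_pos_of_pos hy.1 (1 - σ)
    rw [show deriv (fun s => s ^ (1 - σ) * deriv (fun r => w x r t) s) y
      = -(y ^ (1 - σ) * deriv (fun s => deriv (fun r => w r y t) s) x) by linarith, abs_neg,
      abs_mul, abs_of_pos hp, mul_comm]
    exact mul_le_mul_of_nonneg_right h1 hp.le
  have hA : Tendsto (fun s => s ^ (1 - σ) * deriv (fun r => w x r t) s) (𝓝[>] 0)
      (𝓝 (d / muConst σ)) := by
    have := hd.div_const (muConst σ)
    refine this.congr fun y => ?_
    field_simp
  have h1 := flux_expansion hσ (hw.continuousOn_y (Ioo_subset_Icc_self hx)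
    (Ioc_subset_Icc_self ht)) (fun y hy => (differentiableAt_deriv_of_contDiffOn_two hsl hy).1)
    hφ hb hA hh
  have hpow : 0 < h ^ σ := Real.rpow_pos_of_pos hh.1 _
  have hpow2 : h ^ (2 - σ) = h ^ 2 / h ^ σ := by
    rw [Real.rpow_sub hh.1, Real.rpow_two]
  have e : d - nuConst σ / h ^ σ * (w x h t - w x 0 t)
      = -(nuConst σ / h ^ σ * (w x h t - w x 0 t - d / muConst σ / σ * h ^ σ)) := by
    have := hσ.1.ne'
    unfold nuConst
    field_simp
    ring
  rw [e, abs_neg, abs_mul, abs_of_pos (div_pos hν hpow), hpow2]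
  calc _ ≤ nuConst σ / h ^ σ * (B / (2 * (2 - σ)) * h ^ 2) :=
        mul_le_mul_of_nonneg_left h1 (div_pos hν hpow).le
    _ = _ := by ring

lemma IsRegular.continuousOn_derivWithin (hreg : IsRegular σ m X Y T w) (hT : 0 < T) {x : ℝ}
    (hx : x ∈ Icc (-X) X) :
    ContinuousOn (derivWithin (fun τ => w x 0 τ ^ (1 / m)) (Icc 0 T)) (Icc 0 T) :=
  ((hreg.time_contDiffOn x hx).derivWithin (m := 1) (uniqueDiffOn_Icc hT)
    (by norm_num)).continuousOn

lemma IsRegular.hasDerivWithinAt (hreg : IsRegular σ m X Y T w) {x t : ℝ}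
    (hx : x ∈ Icc (-X) X) (ht : t ∈ Icc 0 T) :
    HasDerivWithinAt (fun τ => w x 0 τ ^ (1 / m))
      (derivWithin (fun τ => w x 0 τ ^ (1 / m)) (Icc 0 T) t) (Icc 0 T) t :=
  (((hreg.time_contDiffOn x hx).differentiableOn (by norm_num)) t ht).hasDerivWithinAt

/-- The difference quotient of the scheme approximates the time derivative on the base. -/
theorem IsRegular.exists_flux_consistency (hreg : IsRegular σ m X Y T w)
    (hw : IsClassicalSolution σ m X Y T f w) (hσ : σ ∈ Ioo (0 : ℝ) 2) (hX : 0 < X) (hY : 0 < Y)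
    (hT : 0 < T) :
    ∃ C ≥ 0, ∀ x ∈ Ioo (-X) X, ∀ t ∈ Icc 0 T, ∀ h ∈ Ioc 0 Y,
      |derivWithin (fun τ => w x 0 τ ^ (1 / m)) (Icc 0 T) t
        - nuConst σ / h ^ σ * (w x h t - w x 0 t)| ≤ C * h ^ (2 - σ) := by
  obtain ⟨B, hB⟩ := hreg.space_bound
  have hB0 : 0 ≤ B := (abs_nonneg _).trans
    (hB 0 ⟨by linarith, hX⟩ (Y / 2) ⟨by linarith, by linarith⟩ T ⟨hT, le_rfl⟩)
  have h2σ : 0 < 2 - σ := by linarith [hσ.2]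
  refine ⟨nuConst σ * (B / (2 * (2 - σ))), mul_nonneg (nuConst_pos hσ).le (by positivity), ?_⟩
  intro x hx t ht h hh
  have hx' := Ioo_subset_Icc_self hx
  have hpos : ∀ t ∈ Ioc 0 T, |derivWithin (fun τ => w x 0 τ ^ (1 / m)) (Icc 0 T) t
        - nuConst σ / h ^ σ * (w x h t - w x 0 t)|
        ≤ nuConst σ * (B / (2 * (2 - σ))) * h ^ (2 - σ) := by
    intro t ht
    obtain ⟨d, hd1, hd2⟩ := hw.base_eq x hx' t ht
    rw [hd2.derivWithin (uniqueDiffOn_Icc hT t (Ioc_subset_Icc_self ht))]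
    exact hw.sigmaDeriv_expansion hσ hB hx ht hd1 hh
  -- The equations hold only for `t > 0`; both sides of the estimate pass to the limit `t → 0`.
  rcases ht.1.eq_or_lt with h0 | h0
  · subst h0
    have : (𝓝[Ioc 0 T] (0 : ℝ)).NeBot := left_nhdsWithin_Ioc_neBot hT
    have hcont : ContinuousOn (fun t => |derivWithin (fun τ => w x 0 τ ^ (1 / m)) (Icc 0 T) t
        - nuConst σ / h ^ σ * (w x h t - w x 0 t)|) (Icc 0 T) :=
      ((hreg.continuousOn_derivWithin hT hx').sub (continuousOn_const.mul
        ((hw.continuousOn_t hx' ⟨hh.1.le, hh.2⟩).sub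
          (hw.continuousOn_t hx' ⟨le_rfl, hY.le⟩)))).abs
    refine le_of_tendsto ((hcont 0 ht).mono_left (nhdsWithin_mono _ Ioc_subset_Icc_self)) ?_
    filter_upwards [self_mem_nhdsWithin] with s hs using hpos s hs
  · exact hpos t ⟨h0, ht.2⟩

/-- Second order Taylor bound in time. -/
lemma IsRegular.exists_taylor (hreg : IsRegular σ m X Y T w) (hX : 0 < X) (hT : 0 < T) :
    ∃ B ≥ 0, ∀ x ∈ Icc (-X) X, ∀ t ∈ Icc 0 T, ∀ s ∈ Icc 0 T, t ≤ s →
      |w x 0 s ^ (1 / m) - w x 0 t ^ (1 / m)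
        - (s - t) * derivWithin (fun τ => w x 0 τ ^ (1 / m)) (Icc 0 T) t| ≤ B * (s - t) ^ 2 := by
  obtain ⟨B, hB⟩ := hreg.time_bound
  have hB0 : 0 ≤ B := (abs_nonneg _).trans
    (hB 0 ⟨by linarith, hX.le⟩ 0 ⟨le_rfl, hT.le⟩)
  refine ⟨B, hB0, fun x hx t ht s hs hts => ?_⟩
  set g := fun τ => w x 0 τ ^ (1 / m) with hg
  set g' := derivWithin g (Icc 0 T) with hg'
  have hd2 : ∀ r ∈ Icc 0 T, HasDerivWithinAt g' (derivWithin g' (Icc 0 T) r) (Icc 0 T) r :=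
    fun r hr => (((hreg.time_contDiffOn x hx).derivWithin (m := 1) (uniqueDiffOn_Icc hT)
      (by norm_num)).differentiableOn (by norm_num) r hr).hasDerivWithinAt
  have hlip : ∀ r ∈ Icc t s, |g' r - g' t| ≤ B * (s - t) := by
    intro r hr
    have hr' : r ∈ Icc 0 T := ⟨ht.1.trans hr.1, hr.2.trans hs.2⟩
    have h1 := Convex.norm_image_sub_le_of_norm_hasDerivWithin_le (C := B) hd2
      (fun q hq => by
        have := hB x hx q hq
        rw [iteratedDerivWithin_succ, iteratedDerivWithin_one] at this
        exact this) (convex_Icc _ _) ht hr'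
    rw [Real.norm_eq_abs, Real.norm_eq_abs, abs_of_nonneg (sub_nonneg.2 hr.1)] at h1
    exact h1.trans (mul_le_mul_of_nonneg_left (by linarith [hr.2]) hB0)
  have hsub : Icc t s ⊆ Icc 0 T := Icc_subset_Icc ht.1 hs.2
  have h2 := Convex.norm_image_sub_le_of_norm_hasDerivWithin_le (C := B * (s - t))
    (f := fun r => g r - r * g' t) (f' := fun r => g' r - g' t) (s := Icc t s) (x := t) (y := s)
    (fun r hr => by
      have h3 := ((hreg.hasDerivWithinAt hx (hsub hr)).mono hsub).sub
        ((hasDerivWithinAt_id r (Icc t s)).mul_const (g' t))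
      rw [one_mul] at h3
      exact h3) hlip (convex_Icc _ _) ⟨le_rfl, hts⟩ ⟨hts, le_rfl⟩
  rw [Real.norm_eq_abs, Real.norm_eq_abs, abs_of_nonneg (sub_nonneg.2 hts)] at h2
  calc _ = |g s - s * g' t - (g t - t * g' t)| := by congr 1; ring
    _ ≤ B * (s - t) * (s - t) := h2
    _ = _ := by ring

/-! ### Relative growth of `u` on the base -/

lemma rpow_sub_rpow_le {a b q : ℝ} (ha : 0 ≤ a) (hab : a ≤ b) (hq : 1 ≤ q) :
    b ^ q - a ^ q ≤ q * b ^ (q - 1) * (b - a) := by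
  refine Convex.image_sub_le_mul_sub_of_deriv_le (convex_Icc a b)
    (f := fun s : ℝ => s ^ q) (fun y _ => (Real.continuousAt_rpow_const y q
      (Or.inr (by linarith))).continuousWithinAt) (fun y hy => ?_) ?_ a
    ⟨le_rfl, hab⟩ b ⟨hab, le_rfl⟩ hab
  · rw [interior_Icc] at hy
    exact (Real.hasDerivAt_rpow_const
      (Or.inl (ha.trans_lt hy.1).ne')).differentiableAt.differentiableWithinAt
  · intro y hy
    rw [interior_Icc] at hy
    have hy0 := ha.trans_lt hy.1
    rw [(Real.hasDerivAt_rpow_const (Or.inl hy0.ne')).deriv]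
    exact mul_le_mul_of_nonneg_left (Real.rpow_le_rpow hy0.le hy.2.le (by linarith)) (by linarith)

/-- On the base, the time derivative of `u = w^(1/m)` is at most a multiple of `u`. -/
theorem IsRegular.exists_deriv_le (hreg : IsRegular σ m X Y T w)
    (hw : IsClassicalSolution σ m X Y T f w) (hσ : σ ∈ Ioo (0 : ℝ) 2) (hm : 1 < m) (hX : 0 < X)
    (hY : 0 < Y) (hT : 0 < T) :
    ∃ C ≥ 0, ∀ x ∈ Ioo (-X) X, ∀ t ∈ Icc 0 T,
      derivWithin (fun τ => w x 0 τ ^ (1 / m)) (Icc 0 T) t ≤ C * w x 0 t ^ (1 / m) := by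
  obtain ⟨C, hC0, hC⟩ := hreg.exists_flux_consistency hw hσ hX hY hT
  obtain ⟨R, hR⟩ := hreg.base_bound
  have hν := nuConst_pos hσ
  have hm0 : 0 < m := by linarith
  have hp : 0 < m - 1 := by linarith
  set R' := |R| / m with hR'
  have hR'0 : 0 ≤ R' := by positivity
  refine ⟨nuConst σ * (m / (m - 1) * R'), by positivity, fun x hx t ht => ?_⟩
  have hx' := Ioo_subset_Icc_self hx
  set u := w x 0 t ^ (1 / m) with hu
  have hw0 := hw.nonneg x hx' 0 ⟨le_rfl, hY.le⟩ t ht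
  have hu0 : 0 ≤ u := Real.rpow_nonneg hw0 _
  have hq : 1 ≤ m / (m - 1) := by rw [le_div_iff₀ hp]; linarith
  have hq1 : m / (m - 1) - 1 = 1 / (m - 1) := by field_simp; ring
  have hroot : ∀ {b : ℝ}, 0 ≤ b → ((b ^ (1 / m)) ^ (m - 1)) ^ (m / (m - 1)) = b := by
    intro b hb
    rw [← Real.rpow_mul hb, ← Real.rpow_mul hb]
    convert Real.rpow_one b using 2
    field_simp
  -- Writing `w = (u^(m-1))^(m/(m-1))`, the hypothesis on `φ'(u)` bounds `w(x,h) - w(x,0)` by a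
  -- multiple of `h^σ`, which cancels the `h^(-σ)` of the quotient. As `h → 0` the remaining factor
  -- `(u^(m-1))^(1/(m-1))` becomes `u`.
  have hub : ∀ h ∈ Ioc 0 Y, derivWithin (fun τ => w x 0 τ ^ (1 / m)) (Icc 0 T) t
      ≤ nuConst σ * (m / (m - 1) * (u ^ (m - 1) + R' * h ^ σ) ^ (1 / (m - 1)) * R')
        + C * h ^ (2 - σ) := by
    intro h hh
    have hhI : h ∈ Icc 0 Y := ⟨hh.1.le, hh.2⟩
    have hw1 := hw.nonneg x hx' h hhI t ht
    have h1 := (abs_le.1 (hC x hx t ht h hh)).2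
    have hpow : 0 < h ^ σ := Real.rpow_pos_of_pos hh.1 _
    have h2 : (w x h t ^ (1 / m)) ^ (m - 1) ≤ u ^ (m - 1) + R' * h ^ σ := by
      have h3 := (abs_le.1 (hR x hx' h hhI t ht)).2
      have h4 : R * h ^ σ ≤ |R| * h ^ σ := mul_le_mul_of_nonneg_right (le_abs_self R) hpow.le
      have h5 : m * (R' * h ^ σ) = |R| * h ^ σ := by rw [hR']; field_simp
      nlinarith
    have h3 : w x h t ≤ (u ^ (m - 1) + R' * h ^ σ) ^ (m / (m - 1)) := by
      rw [← hroot hw1]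
      exact Real.rpow_le_rpow (Real.rpow_nonneg (Real.rpow_nonneg hw1 _) _) h2 (by linarith)
    have h4 := rpow_sub_rpow_le (a := u ^ (m - 1)) (b := u ^ (m - 1) + R' * h ^ σ)
      (Real.rpow_nonneg hu0 _) (by nlinarith) hq
    rw [hq1, hroot hw0] at h4
    have h5 : nuConst σ / h ^ σ * (w x h t - w x 0 t)
        ≤ nuConst σ / h ^ σ * (m / (m - 1) * (u ^ (m - 1) + R' * h ^ σ) ^ (1 / (m - 1))
          * (R' * h ^ σ)) :=
      mul_le_mul_of_nonneg_left (by linarith) (by positivity)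
    have h6 : nuConst σ / h ^ σ * (m / (m - 1) * (u ^ (m - 1) + R' * h ^ σ) ^ (1 / (m - 1))
          * (R' * h ^ σ))
        = nuConst σ * (m / (m - 1) * (u ^ (m - 1) + R' * h ^ σ) ^ (1 / (m - 1)) * R') := by
      field_simp
    linarith
  have h2σ : 0 < 2 - σ := by linarith [hσ.2]
  have hlim : Tendsto (fun h : ℝ =>
      nuConst σ * (m / (m - 1) * (u ^ (m - 1) + R' * h ^ σ) ^ (1 / (m - 1)) * R')
        + C * h ^ (2 - σ)) (𝓝[>] 0) (𝓝 (nuConst σ * (m / (m - 1) * R') * u)) := by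
    have hcont : ContinuousAt (fun h : ℝ =>
      nuConst σ * (m / (m - 1) * (u ^ (m - 1) + R' * h ^ σ) ^ (1 / (m - 1)) * R')
        + C * h ^ (2 - σ)) 0 := by
      have c1 : ContinuousAt (fun h : ℝ => h ^ σ) 0 :=
        Real.continuousAt_rpow_const 0 σ (Or.inr hσ.1.le)
      have c2 : ContinuousAt (fun h : ℝ => h ^ (2 - σ)) 0 :=
        Real.continuousAt_rpow_const 0 _ (Or.inr h2σ.le)
      have c3 : ContinuousAt (fun h : ℝ => (u ^ (m - 1) + R' * h ^ σ) ^ (1 / (m - 1))) 0 :=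
        ContinuousAt.rpow_const (continuousAt_const.add (continuousAt_const.mul c1))
          (Or.inr (by positivity))
      exact (continuousAt_const.mul ((continuousAt_const.mul c3).mul continuousAt_const)).add
        (continuousAt_const.mul c2)
    have := hcont.tendsto
    rw [Real.zero_rpow hσ.1.ne', Real.zero_rpow h2σ.ne', mul_zero, mul_zero, add_zero, add_zero,
      ← Real.rpow_mul hu0, mul_one_div_cancel hp.ne', Real.rpow_one] at this
    refine (this.mono_left nhdsWithin_le_nhds).trans_eq ?_
    congr 1; ring
  refine ge_of_tendsto hlim ?_
  filter_upwards [Ioc_mem_nhdsGT hY] with h hh using hub h hh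

/-- Growth bound for `u = w^(1/m)` on the base. -/
theorem IsRegular.exists_growth (hreg : IsRegular σ m X Y T w)
    (hw : IsClassicalSolution σ m X Y T f w) (hσ : σ ∈ Ioo (0 : ℝ) 2) (hm : 1 < m) (hX : 0 < X)
    (hY : 0 < Y) (hT : 0 < T) :
    ∃ C ≥ 0, ∀ x ∈ Ioo (-X) X, ∀ t ∈ Icc 0 T, ∀ s ∈ Icc 0 T, t ≤ s →
      w x 0 s ^ (1 / m) ≤ Real.exp (C * (s - t)) * w x 0 t ^ (1 / m) := by
  obtain ⟨C, hC0, hC⟩ := hreg.exists_deriv_le hw hσ hm hX hY hT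
  refine ⟨C, hC0, fun x hx t ht s hs hts => ?_⟩
  have hx' := Ioo_subset_Icc_self hx
  have hexp : ∀ r, HasDerivAt (fun r => Real.exp (-C * r)) (Real.exp (-C * r) * (-C * 1)) r :=
    fun r => ((hasDerivAt_id r).const_mul (-C)).exp
  have hcu : ContinuousOn (fun τ => w x 0 τ ^ (1 / m)) (Icc 0 T) :=
    (hreg.time_contDiffOn x hx').continuousOn
  have hder : ∀ r ∈ Ioo 0 T, HasDerivAt (fun r => Real.exp (-C * r) * w x 0 r ^ (1 / m))
      (Real.exp (-C * r) * (-C * 1) * w x 0 r ^ (1 / m)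
        + Real.exp (-C * r) * derivWithin (fun τ => w x 0 τ ^ (1 / m)) (Icc 0 T) r) r :=
    fun r hr => (hexp r).mul ((hreg.hasDerivWithinAt hx' (Ioo_subset_Icc_self hr)).hasDerivAt
      (Icc_mem_nhds hr.1 hr.2))
  -- Grönwall with an integrating factor: `exp(-C r) u(r)` is nonincreasing.
  have hanti : AntitoneOn (fun r => Real.exp (-C * r) * w x 0 r ^ (1 / m)) (Icc 0 T) := by
    refine antitoneOn_of_deriv_nonpos (convex_Icc _ _)
      (ContinuousOn.mul (by fun_prop) hcu) ?_ ?_ <;> rw [interior_Icc]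
    · exact fun r hr => (hder r hr).differentiableAt.differentiableWithinAt
    · intro r hr
      rw [(hder r hr).deriv]
      have h1 := hC x hx r (Ioo_subset_Icc_self hr)
      have h2 := mul_le_mul_of_nonneg_left h1 (Real.exp_pos (-C * r)).le
      linarith
  have h1 := mul_le_mul_of_nonneg_left (hanti ht hs hts) (Real.exp_pos (C * s)).le
  simp only at h1
  rw [← mul_assoc, ← mul_assoc, ← Real.exp_add, ← Real.exp_add] at h1
  rwa [show C * s + -C * s = 0 by ring, Real.exp_zero, one_mul,
    show C * s + -C * t = C * (s - t) by ring] at h1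

end Solution

/-! ### Nodes of the mesh -/

namespace Mesh

variable {X Y : ℝ} (M : Mesh X Y)

lemma dx_pos (hX : 0 < X) : 0 < M.dx := by
  have : (0 : ℝ) < M.I := by exact_mod_cast M.I_pos
  unfold dx
  positivity

lemma I_mul_dx : M.I * M.dx = 2 * X := by
  have : (M.I : ℝ) ≠ 0 := by exact_mod_cast M.I_pos.ne'
  unfold dx
  field_simp

lemma K_mul_dx : M.K * M.dx = Y := by
  have : (M.K : ℝ) ≠ 0 := by exact_mod_cast M.K_pos.ne'
  unfold dx
  rw [M.square]
  field_simp

lemma dx_le (hX : 0 < X) : M.dx ≤ Y := by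
  have h1 : (1 : ℝ) ≤ M.K := by exact_mod_cast M.K_pos
  have h2 := M.K_mul_dx
  nlinarith [M.dx_pos hX]

lemma xNode_mem (hX : 0 < X) (i : Fin (M.I + 1)) : M.xNode i ∈ Icc (-X) X := by
  have h1 : ((i : ℕ) : ℝ) ≤ M.I := by exact_mod_cast Nat.lt_succ_iff.1 i.2
  have h2 := M.I_mul_dx
  have h3 := M.dx_pos hX
  have h4 : (0 : ℝ) ≤ (i : ℕ) := Nat.cast_nonneg _
  constructor <;> unfold xNode <;> nlinarith

lemma xNode_mem_Ioo (hX : 0 < X) {i : Fin (M.I + 1)} (h0 : 0 < (i : ℕ)) (hI : (i : ℕ) < M.I) :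
    M.xNode i ∈ Ioo (-X) X := by
  have h1 : ((i : ℕ) : ℝ) < M.I := by exact_mod_cast hI
  have h2 := M.I_mul_dx
  have h3 := M.dx_pos hX
  have h4 : (0 : ℝ) < (i : ℕ) := by exact_mod_cast h0
  constructor <;> unfold xNode <;> nlinarith

lemma xNode_of_eq {i : Fin (M.I + 1)} (h : (i : ℕ) = 0 ∨ (i : ℕ) = M.I) :
    M.xNode i = -X ∨ M.xNode i = X := by
  unfold xNode
  rcases h with h | h
  · left; simp [h]
  · right; rw [h, M.I_mul_dx]; ring

lemma yNode_mem (hX : 0 < X) (k : Fin (M.K + 1)) : M.yNode k ∈ Icc 0 Y := by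
  have h1 : ((k : ℕ) : ℝ) ≤ M.K := by exact_mod_cast Nat.lt_succ_iff.1 k.2
  have h2 := M.K_mul_dx
  have h3 := M.dx_pos hX
  have h4 : (0 : ℝ) ≤ (k : ℕ) := Nat.cast_nonneg _
  constructor <;> unfold yNode <;> nlinarith

lemma yNode_mem_Ioo (hX : 0 < X) {k : Fin (M.K + 1)} (h0 : 0 < (k : ℕ)) (hK : (k : ℕ) < M.K) :
    M.yNode k ∈ Ioo 0 Y := by
  have h1 : ((k : ℕ) : ℝ) < M.K := by exact_mod_cast hK
  have h2 := M.K_mul_dx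
  have h3 := M.dx_pos hX
  have h4 : (0 : ℝ) < (k : ℕ) := by exact_mod_cast h0
  constructor <;> unfold yNode <;> nlinarith

lemma yNode_zero : M.yNode 0 = 0 := by simp [yNode]

lemma yNode_kOne : M.yNode M.kOne = M.dx := by simp [yNode, kOne]

/-- A boundary node lies on the lateral sides, on the top, or in the interior of the base. -/
lemma boundary_cases {i : Fin (M.I + 1)} {k : Fin (M.K + 1)} (h : ¬ M.Interior i k) :
    ((i : ℕ) = 0 ∨ (i : ℕ) = M.I ∨ (k : ℕ) = M.K) ∨ (0 < (i : ℕ) ∧ (i : ℕ) < M.I ∧ k = 0) := by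
  have hi := i.2
  have hk := k.2
  unfold Interior at h
  by_cases hl : (i : ℕ) = 0 ∨ (i : ℕ) = M.I ∨ (k : ℕ) = M.K
  · exact Or.inl hl
  · right
    refine ⟨by omega, by omega, Fin.ext ?_⟩
    simp only [Fin.val_zero]
    omega

end Mesh

/-! ### Stability of the discretization -/

/-- A smooth nonnegative barrier on which the extension operator is bounded below. -/
lemma exists_barrier {σ : ℝ} (hσ : σ ∈ Ioo (0 : ℝ) 2) (X : ℝ) {Y : ℝ} (hY : 0 < Y) :
    ∃ ψ : ℝ → ℝ → ℝ, ContDiff ℝ ∞ (fun p : ℝ × ℝ => ψ p.1 p.2) ∧ ∃ c > 0, ∃ B ≥ 0,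
      (∀ x ∈ Icc (-X) X, ∀ y ∈ Icc 0 Y, 0 ≤ ψ x y ∧ ψ x y ≤ B) ∧
      ∀ x, ∀ y ∈ Ioo 0 Y, c ≤ extOp σ ψ x y := by
  -- The barrier is `y` for `σ < 1` and `x²` for `σ ≥ 1`: in both cases `L_σ ψ` is a positive
  -- multiple of a nonpositive power of `y`, hence smallest at `y = Y`.
  rcases lt_or_ge σ 1 with h1 | h1
  · refine ⟨fun _ y => y, contDiff_snd, (1 - σ) * Y ^ (-σ),
      mul_pos (by linarith) (Real.rpow_pos_of_pos hY _), Y, hY.le, fun _ _ y hy => hy, ?_⟩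
    intro x y hy
    have e : extOp σ (fun _ y => y) x y = (1 - σ) * y ^ (1 - σ - 1) := by
      have h3 : HasDerivAt (fun s : ℝ => s ^ (1 - σ)) ((1 - σ) * y ^ (1 - σ - 1)) y :=
        Real.hasDerivAt_rpow_const (Or.inl hy.1.ne')
      simp [extOp, h3.deriv]
    rw [e, show 1 - σ - 1 = -σ by ring]
    exact mul_le_mul_of_nonneg_left
      (Real.rpow_le_rpow_of_nonpos hy.1 hy.2.le (by linarith [hσ.1])) (by linarith)
  · refine ⟨fun x _ => x ^ 2, contDiff_fst.pow 2, 2 * Y ^ (1 - σ),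
      mul_pos two_pos (Real.rpow_pos_of_pos hY _), X ^ 2, sq_nonneg X,
      fun x hx _ _ => ⟨sq_nonneg x, sq_le_sq' hx.1 hx.2⟩, ?_⟩
    intro x y hy
    have e : extOp σ (fun x _ => x ^ 2) x y = 2 * y ^ (1 - σ) := by
      have h3 : (fun s : ℝ => y ^ (1 - σ) * deriv (fun r : ℝ => r ^ 2) s)
          = fun s => (y ^ (1 - σ) * 2) * s := by
        funext s; simp; ring
      unfold extOp
      rw [h3]
      simp; ring
    rw [e]
    exact mul_le_mul_of_nonneg_left
      (Real.rpow_le_rpow_of_nonpos hy.1 hy.2.le (by linarith)) two_pos.le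

section Discrete

variable {σ m X Y T a : ℝ} {f : ℝ → ℝ} {w : ℝ → ℝ → ℝ → ℝ} {LD : Discretization X Y}
  {R : Set (ℝ → ℝ → ℝ → ℝ)}

/-- On fine meshes a grid function is controlled by its boundary values and its image. -/
theorem Discretization.MaxPrinciple.exists_stability (hmax : LD.MaxPrinciple)
    (hσ : σ ∈ Ioo (0 : ℝ) 2) (hX : 0 < X) (hY : 0 < Y) (hT : 0 < T) (ha : 0 < a)
    (hsmooth : ∀ v : ℝ → ℝ → ℝ, ContDiff ℝ ∞ (fun p : ℝ × ℝ => v p.1 p.2) →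
      (fun x y _ => v x y) ∈ R) (hord : LD.HasOrder σ T a R) :
    ∃ c ≥ 0, ∃ h₁ > 0, ∀ M : Mesh X Y, M.dx ≤ h₁ → ∀ (Z : M.Grid) (ε E : ℝ), 0 ≤ ε →
      (∀ i k, M.Interior i k → |LD M Z i k| ≤ ε) → (∀ i k, ¬ M.Interior i k → |Z i k| ≤ E) →
      ∀ i k, |Z i k| ≤ E + c * ε := by
  obtain ⟨ψ, hψs, c₀, hc₀, B, hB0, hψB, hψL⟩ := exists_barrier hσ X hY
  obtain ⟨C, h₀, hh₀, hC⟩ := hord _ (hsmooth ψ hψs)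
  have hq : 0 < c₀ / (2 * (|C| + 1)) := by positivity
  -- The threshold makes the consistency error of the barrier at most `c₀/2`, so that its discrete
  -- image stays above `c₀/2`; adding `2ε/c₀` times the barrier then compensates a residual `-ε`.
  refine ⟨2 * B / c₀, by positivity, min h₀ ((c₀ / (2 * (|C| + 1))) ^ (1 / a)),
    lt_min hh₀ (Real.rpow_pos_of_pos hq _), ?_⟩
  intro M hM
  have hdx := M.dx_pos hX
  have hLψ : ∀ i k, M.Interior i k → c₀ / 2 ≤ LD M (M.restrict ψ) i k := by
    intro i k hik
    have h1 := (abs_le.1 (hC M (hM.trans (min_le_left _ _)) i k hik T ⟨hT, le_rfl⟩)).1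
    have h2 := hψL (M.xNode i) (M.yNode k) (M.yNode_mem_Ioo hX hik.2.1 hik.2.2)
    have h3 : M.dx ^ a ≤ c₀ / (2 * (|C| + 1)) := by
      have := Real.rpow_le_rpow hdx.le (hM.trans (min_le_right _ _)) ha.le
      rwa [← Real.rpow_mul hq.le, one_div_mul_cancel ha.ne', Real.rpow_one] at this
    have h4 : C * M.dx ^ a ≤ c₀ / 2 := by
      have h5 : C * M.dx ^ a ≤ (|C| + 1) * M.dx ^ a :=
        mul_le_mul_of_nonneg_right (by linarith [le_abs_self C]) (by positivity)
      have h6 : (|C| + 1) * M.dx ^ a ≤ (|C| + 1) * (c₀ / (2 * (|C| + 1))) :=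
        mul_le_mul_of_nonneg_left h3 (by positivity)
      have h7 : (|C| + 1) * (c₀ / (2 * (|C| + 1))) = c₀ / 2 := by field_simp
      linarith
    linarith
  have one_side : ∀ (Z : M.Grid) (ε E : ℝ), 0 ≤ ε → (∀ i k, M.Interior i k → -ε ≤ LD M Z i k) →
      (∀ i k, ¬ M.Interior i k → Z i k ≤ E) → ∀ i k, Z i k ≤ E + 2 * B / c₀ * ε := by
    intro Z ε E hε hL hb i k
    have hr : 0 ≤ 2 * ε / c₀ := by positivity
    have hψ0 : ∀ i k, 0 ≤ M.restrict ψ i k ∧ M.restrict ψ i k ≤ B := fun i k =>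
      hψB _ (M.xNode_mem hX i) _ (M.yNode_mem hX k)
    have key := hmax M (Z + (2 * ε / c₀) • M.restrict ψ) ?_ (E + 2 * B / c₀ * ε) ?_ i k
    · simp only [Pi.add_apply, Pi.smul_apply, smul_eq_mul] at key
      have := mul_nonneg hr (hψ0 i k).1
      linarith
    · intro i k hik
      simp only [map_add, map_smul, Pi.add_apply, Pi.smul_apply, smul_eq_mul]
      have h1 := mul_le_mul_of_nonneg_left (hLψ i k hik) hr
      have h2 : 2 * ε / c₀ * (c₀ / 2) = ε := by field_simp
      linarith [hL i k hik]
    · intro i k hik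
      simp only [Pi.add_apply, Pi.smul_apply, smul_eq_mul]
      have h1 := mul_le_mul_of_nonneg_left (hψ0 i k).2 hr
      have h2 : 2 * ε / c₀ * B = 2 * B / c₀ * ε := by ring
      linarith [hb i k hik]
  intro Z ε E hε hL hb i k
  rw [abs_le']
  refine ⟨one_side Z ε E hε (fun i k h => (abs_le.1 (hL i k h)).1)
    (fun i k h => (abs_le.1 (hb i k h)).2) i k, ?_⟩
  have := one_side (-Z) ε E hε (fun i k h => ?_) (fun i k h => ?_) i k
  · simpa using this
  · simp only [map_neg, Pi.neg_apply]
    linarith [(abs_le.1 (hL i k h)).2]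
  · simp only [Pi.neg_apply]
    linarith [(abs_le.1 (hb i k h)).1]

/-- The residual of the exact solution is `O(Δx^a)`, also at the initial time. -/
lemma Discretization.HasOrder.exists_residual (hord : LD.HasOrder σ T a R) (hwR : w ∈ R)
    (hw : IsClassicalSolution σ m X Y T f w) (hX : 0 < X) (hT : 0 < T) :
    ∃ C ≥ 0, ∃ h₀ > 0, ∀ M : Mesh X Y, M.dx ≤ h₀ → ∀ i k, M.Interior i k → ∀ t ∈ Icc 0 T,
      |LD M (M.restrict fun x y => w x y t) i k| ≤ C * M.dx ^ a := by
  obtain ⟨C, h₀, hh₀, hC⟩ := hord w hwR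
  refine ⟨|C|, abs_nonneg C, h₀, hh₀, fun M hM i k hik t ht => ?_⟩
  have hdx := M.dx_pos hX
  have hpos : ∀ t ∈ Ioc 0 T, |LD M (M.restrict fun x y => w x y t) i k| ≤ |C| * M.dx ^ a := by
    intro t ht
    have h1 := hC M hM i k hik t ht
    rw [hw.ext_eq _ (M.xNode_mem_Ioo hX hik.1.1 hik.1.2) _ (M.yNode_mem_Ioo hX hik.2.1 hik.2.2)
      t ht, sub_zero] at h1
    exact h1.trans (mul_le_mul_of_nonneg_right (le_abs_self C) (by positivity))
  rcases ht.1.eq_or_lt with h0 | h0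
  · subst h0
    have : (𝓝[Ioc 0 T] (0 : ℝ)).NeBot := left_nhdsWithin_Ioc_neBot hT
    have hr : ContinuousOn (fun t => M.restrict fun x y => w x y t) (Icc 0 T) :=
      continuousOn_pi.2 fun i => continuousOn_pi.2 fun k =>
        hw.continuousOn_t (M.xNode_mem hX i) (M.yNode_mem hX k)
    have hcont : ContinuousOn (fun t => |LD M (M.restrict fun x y => w x y t) i k|) (Icc 0 T) := by
      have h2 := (LD M).continuous_of_finiteDimensional.comp_continuousOn hr
      exact (continuousOn_pi.1 (continuousOn_pi.1 h2 i) k).abs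
    refine le_of_tendsto ((hcont 0 ht).mono_left (nhdsWithin_mono _ Ioc_subset_Icc_self)) ?_
    filter_upwards [self_mem_nhdsWithin] with s hs using hpos s hs
  · exact hpos t ⟨h0, ht.2⟩

/-- The error at all nodes is controlled by the error on the base. -/
theorem exists_error_le_base (hmax : LD.MaxPrinciple)
    (hσ : σ ∈ Ioo (0 : ℝ) 2) (hX : 0 < X) (hY : 0 < Y) (hT : 0 < T) (ha : 0 < a)
    (hsmooth : ∀ v : ℝ → ℝ → ℝ, ContDiff ℝ ∞ (fun p : ℝ × ℝ => v p.1 p.2) →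
      (fun x y _ => v x y) ∈ R) (hord : LD.HasOrder σ T a R) (hwR : w ∈ R)
    (hw : IsClassicalSolution σ m X Y T f w) :
    ∃ C ≥ 0, ∃ h₁ > 0, ∀ M : Mesh X Y, M.dx ≤ h₁ → ∀ V : M.Grid,
      (∀ i k, M.Interior i k → LD M V i k = 0) →
      (∀ (i : Fin (M.I + 1)) (k : Fin (M.K + 1)),
        ((i : ℕ) = 0 ∨ (i : ℕ) = M.I ∨ (k : ℕ) = M.K) → V i k = 0) →
      ∀ t ∈ Icc 0 T, ∀ E ≥ 0,
        (∀ i : Fin (M.I + 1), 0 < (i : ℕ) → (i : ℕ) < M.I → |w (M.xNode i) 0 t - V i 0| ≤ E) →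
        ∀ i k, |w (M.xNode i) (M.yNode k) t - V i k| ≤ E + C * M.dx ^ a := by
  obtain ⟨c, hc, h₁, hh₁, hst⟩ := hmax.exists_stability hσ hX hY hT ha hsmooth hord
  obtain ⟨C, hC0, h₀, hh₀, hC⟩ := hord.exists_residual hwR hw hX hT
  refine ⟨c * C, mul_nonneg hc hC0, min h₁ h₀, lt_min hh₁ hh₀, ?_⟩
  intro M hM V hV hlat t ht E hE hbase i k
  have hdx := M.dx_pos hX
  have h := hst M (hM.trans (min_le_left _ _)) ((M.restrict fun x y => w x y t) - V)
    (C * M.dx ^ a) E (by positivity) ?_ ?_ i k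
  · rw [mul_assoc]
    exact h
  · intro i k hik
    simp only [map_sub, Pi.sub_apply, hV i k hik, sub_zero]
    exact hC M (hM.trans (min_le_right _ _)) i k hik t ht
  · intro i k hik
    simp only [Pi.sub_apply, Mesh.restrict]
    rcases M.boundary_cases hik with h | ⟨h0, hI, rfl⟩
    · rw [hlat i k h, sub_zero]
      have : w (M.xNode i) (M.yNode k) t = 0 := by
        rw [← or_assoc] at h
        rcases h with h | h
        · exact hw.lateral_zero hX hY (M.xNode_of_eq h) (M.yNode_mem hX k) ht
        · rw [show M.yNode k = Y by rw [Mesh.yNode, h, M.K_mul_dx]]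
          exact hw.top_zero _ (M.xNode_mem hX i) t ht
      rw [this, abs_zero]
      exact hE
    · rw [M.yNode_zero]
      exact hbase i h0 hI

/-! ### Bounds for the numerical solution -/

/-- This is where the CFL condition acts: it says that `1 - λ m s^(m-1) ≥ 0` up to `s = S`. -/
lemma sub_mul_rpow_mono {m lam S a b : ℝ} (hm : 1 ≤ m) (hlam : 0 ≤ lam)
    (hcfl : m * S ^ (m - 1) * lam ≤ 1) (ha : 0 ≤ a) (hab : a ≤ b) (hb : b ≤ S) :
    a - lam * a ^ m ≤ b - lam * b ^ m := by
  have h1 := rpow_sub_rpow_le ha hab hm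
  have h2 : b ^ (m - 1) ≤ S ^ (m - 1) := Real.rpow_le_rpow (ha.trans hab) hb (by linarith)
  have h3 : lam * (b ^ m - a ^ m) ≤ lam * (m * S ^ (m - 1) * (b - a)) := by
    refine mul_le_mul_of_nonneg_left (h1.trans ?_) hlam
    exact mul_le_mul_of_nonneg_right (mul_le_mul_of_nonneg_left h2 (by linarith)) (by linarith)
  have h4 : lam * (m * S ^ (m - 1) * (b - a)) ≤ 1 * (b - a) := by
    calc _ = (m * S ^ (m - 1) * lam) * (b - a) := by ring
      _ ≤ _ := mul_le_mul_of_nonneg_right hcfl (by linarith)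
  linarith

/-- One explicit step on the base keeps the values between `0` and `S`. -/
lemma explicit_step_mem {m lam S W₀ W₁ : ℝ} (hm : 1 ≤ m) (hlam : 0 ≤ lam) (hS : 0 ≤ S)
    (hcfl : m * S ^ (m - 1) * lam ≤ 1) (h0 : W₀ ∈ Icc 0 (S ^ m)) (h1 : W₁ ∈ Icc 0 (S ^ m)) :
    lam * (W₁ - W₀) + W₀ ^ (1 / m) ∈ Icc 0 S := by
  have hm0 : m ≠ 0 := by linarith
  have hUm : (W₀ ^ (1 / m)) ^ m = W₀ := by
    rw [← Real.rpow_mul h0.1, one_div_mul_cancel hm0, Real.rpow_one]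
  have hU0 : 0 ≤ W₀ ^ (1 / m) := Real.rpow_nonneg h0.1 _
  have hUS : W₀ ^ (1 / m) ≤ S := by
    have := Real.rpow_le_rpow h0.1 h0.2 (show 0 ≤ 1 / m by positivity)
    rwa [← Real.rpow_mul hS, mul_one_div_cancel hm0, Real.rpow_one] at this
  have l1 := sub_mul_rpow_mono hm hlam hcfl le_rfl hU0 hUS
  have l2 := sub_mul_rpow_mono hm hlam hcfl hU0 hUS le_rfl
  rw [hUm] at l1 l2
  rw [Real.zero_rpow hm0] at l1
  have := mul_nonneg hlam h1.1
  have := mul_le_mul_of_nonneg_left h1.2 hlam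
  constructor <;> linarith

lemma CFL.mul_le_one {S dt dx : ℝ} (hdx : 0 < dx) (h : m * S ^ (m - 1) * nuConst σ * dt ≤ dx ^ σ) :
    m * S ^ (m - 1) * (nuConst σ * (dt / dx ^ σ)) ≤ 1 := by
  have hp : 0 < dx ^ σ := Real.rpow_pos_of_pos hdx _
  calc _ = m * S ^ (m - 1) * nuConst σ * dt / dx ^ σ := by ring
    _ ≤ 1 := (div_le_one hp).2 h

/-- Induction on time: `explicit_step_mem` preserves the bounds on the base, and the discrete
maximum principle for `W` and `-W` carries them inside. -/
theorem IsNumericalSolution.mem_Icc {M : Mesh X Y} {J : ℕ} {W : ℕ → M.Grid}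
    (hW : IsNumericalSolution LD σ m T f M J W) (hmax : LD.MaxPrinciple) (hm : 1 ≤ m)
    {S : ℝ} (hS : 0 ≤ S) (hf : ∀ x ∈ Icc (-X) X, 0 ≤ f x ∧ f x ≤ S) (hX : 0 < X)
    (hlam : 0 ≤ nuConst σ * ((T / J) / M.dx ^ σ))
    (hcfl : m * S ^ (m - 1) * (nuConst σ * ((T / J) / M.dx ^ σ)) ≤ 1) :
    ∀ j ≤ J, ∀ i k, W j i k ∈ Icc 0 (S ^ m) := by
  have hSm : 0 ≤ S ^ m := Real.rpow_nonneg hS _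
  have hall : ∀ j ≤ J, (∀ i : Fin (M.I + 1), 0 < (i : ℕ) → (i : ℕ) < M.I →
      W j i 0 ∈ Icc 0 (S ^ m)) → ∀ i k, W j i k ∈ Icc 0 (S ^ m) := by
    intro j hj hb i k
    have hbd : ∀ i k, ¬ M.Interior i k → W j i k ∈ Icc 0 (S ^ m) := by
      intro i k hik
      rcases M.boundary_cases hik with h | ⟨h0, hI, rfl⟩
      · rw [hW.lateral j hj i k h]
        exact ⟨le_rfl, hSm⟩
      · exact hb i h0 hI
    constructor
    · have := hmax M (-W j) (fun i k hik => by simp [hW.interior_eq j hj i k hik]) 0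
        (fun i k hik => by simpa using (hbd i k hik).1) i k
      simpa using this
    · exact hmax M (W j) (fun i k hik => by simp [hW.interior_eq j hj i k hik]) (S ^ m)
        (fun i k hik => (hbd i k hik).2) i k
  intro j
  induction j with
  | zero =>
    intro hj
    refine hall 0 hj fun i h0 hI => ?_
    rw [hW.initial i h0 hI]
    obtain ⟨h1, h2⟩ := hf _ (M.xNode_mem hX i)
    exact ⟨Real.rpow_nonneg h1 _, Real.rpow_le_rpow h1 h2 (by linarith)⟩
  | succ j ih =>
    intro hj
    refine hall (j + 1) hj fun i h0 hI => ?_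
    have ih' := ih (by omega)
    rw [hW.step j (by omega) i h0 hI]
    obtain ⟨h1, h2⟩ := explicit_step_mem hm hlam hS hcfl (ih' i 0) (ih' i M.kOne)
    exact ⟨Real.rpow_nonneg h1 _, Real.rpow_le_rpow h1 h2 (by linarith)⟩

end Discrete

/-! ### Propagation of the error in one step -/

/-- Increments of a convex function over a fixed length increase with the base point. -/
lemma add_rpow_sub_rpow_mono {m κ b b' : ℝ} (hm : 1 ≤ m) (hκ : 0 ≤ κ) (hb : 0 ≤ b)
    (hbb : b ≤ b') : (b + κ) ^ m - b ^ m ≤ (b' + κ) ^ m - b' ^ m := by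
  have hd : ∀ x : ℝ, HasDerivAt (fun x : ℝ => (x + κ) ^ m - x ^ m)
      (1 * m * (x + κ) ^ (m - 1) - m * x ^ (m - 1)) x := fun x =>
    (((hasDerivAt_id x).add_const κ).rpow_const (Or.inr hm)).sub
      (Real.hasDerivAt_rpow_const (Or.inr hm))
  have hmono : MonotoneOn (fun x : ℝ => (x + κ) ^ m - x ^ m) (Ici 0) := by
    refine monotoneOn_of_deriv_nonneg (convex_Ici _)
      (fun x _ => (hd x).continuousAt.continuousWithinAt)
      (fun x _ => (hd x).differentiableAt.differentiableWithinAt) fun x hx => ?_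
    rw [interior_Ici] at hx
    rw [(hd x).deriv, one_mul, ← mul_sub]
    have hx0 : (0 : ℝ) < x := hx
    exact mul_nonneg (by linarith) (sub_nonneg.2
      (Real.rpow_le_rpow hx0.le (by linarith) (by linarith)))
  exact hmono hb (hb.trans hbb) hbb

/-- By convexity the worst `v` is `γ u`, and `γ u + (s - u) ≤ γ s` since `γ ≥ 1`; homogeneity then
factors out `γ^m`. -/
lemma shift_up_rpow_le {m γ u s v : ℝ} (hm : 1 ≤ m) (hγ : 1 ≤ γ) (hu : 0 ≤ u) (hus : u ≤ s)
    (hv : 0 ≤ v) (hvu : v ≤ γ * u) : (v + (s - u)) ^ m - v ^ m ≤ γ ^ m * (s ^ m - u ^ m) := by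
  have h1 := add_rpow_sub_rpow_mono hm (sub_nonneg.2 hus) hv hvu
  have h2 : (γ * u + (s - u)) ^ m ≤ (γ * s) ^ m :=
    Real.rpow_le_rpow (by nlinarith) (by nlinarith) (by linarith)
  rw [Real.mul_rpow (by linarith) (by linarith)] at h2
  rw [Real.mul_rpow (by linarith) hu] at h1
  linarith

lemma shift_down_rpow_le {m γ u r v : ℝ} (hm : 1 ≤ m) (hγ : 1 ≤ γ) (hr : 0 ≤ r) (hru : r ≤ u)
    (hb : 0 ≤ v - (u - r)) (hvu : v ≤ γ * u) :
    v ^ m - (v - (u - r)) ^ m ≤ γ ^ m * (u ^ m - r ^ m) := by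
  have h1 := add_rpow_sub_rpow_mono (b' := γ * u - (u - r)) hm (sub_nonneg.2 hru) hb (by linarith)
  rw [sub_add_cancel, sub_add_cancel] at h1
  have h2 : (γ * r) ^ m ≤ (γ * u - (u - r)) ^ m :=
    Real.rpow_le_rpow (by nlinarith) (by nlinarith) (by linarith)
  rw [Real.mul_rpow (by linarith) hr] at h2
  rw [Real.mul_rpow (by linarith) (by linarith)] at h1
  linarith

lemma rpow_sub_rpow_le_of_le_add {m S a b e : ℝ} (hm : 1 ≤ m) (ha : 0 ≤ a) (hb : 0 ≤ b)
    (hbS : b ≤ S) (he : 0 ≤ e) (hbe : b ≤ a + e) : b ^ m - a ^ m ≤ m * S ^ (m - 1) * e := by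
  have hS : 0 ≤ S := hb.trans hbS
  rcases le_total b a with h | h
  · have h1 := Real.rpow_le_rpow hb h (show 0 ≤ m by linarith)
    have : 0 ≤ m * S ^ (m - 1) * e := by positivity
    linarith
  · have h1 := rpow_sub_rpow_le ha h hm
    have h2 : b ^ (m - 1) ≤ S ^ (m - 1) := Real.rpow_le_rpow hb hbS (by linarith)
    refine h1.trans ?_
    exact mul_le_mul (mul_le_mul_of_nonneg_left h2 (by linarith)) (by linarith) (by linarith)
      (by positivity)

/-- The upper bound for one explicit step; past the range `[0, S^m]`, where the step is monotone,
the flux coefficient `lam` is reduced by the factor `S^m / (w₀ + E)`. -/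
lemma explicit_step_upper {m lam S w₀ w₁ W₀ W₁ E η κ : ℝ} (hm : 1 ≤ m) (hlam : 0 ≤ lam)
    (hS : 0 < S) (hcfl : m * S ^ (m - 1) * lam ≤ 1) (hw0 : w₀ ∈ Icc 0 (S ^ m))
    (hW0 : W₀ ∈ Icc 0 (S ^ m)) (hW1 : W₁ ∈ Icc 0 (S ^ m)) (hE : 0 ≤ E) (hη : 0 ≤ η)
    (h0 : |w₀ - W₀| ≤ E) (h1 : |w₁ - W₁| ≤ E + η) (hκ : 0 ≤ κ) (hflux : lam * (w₀ - w₁) ≤ κ) :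
    lam * (W₁ - W₀) + W₀ ^ (1 / m)
      ≤ (w₀ + E) ^ (1 / m) + lam * (w₁ - w₀) + lam * η + κ * E / S ^ m := by
  have hm0 : m ≠ 0 := by linarith
  have hmi : 0 ≤ 1 / m := by positivity
  have hSm : 0 < S ^ m := Real.rpow_pos_of_pos hS _
  have hroot : ∀ {b : ℝ}, 0 ≤ b → (b ^ (1 / m)) ^ m = b := fun {b} hb => by
    rw [← Real.rpow_mul hb, one_div_mul_cancel hm0, Real.rpow_one]
  have hrootS : (S ^ m) ^ (1 / m) = S := by
    rw [← Real.rpow_mul hS.le, mul_one_div_cancel hm0, Real.rpow_one]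
  have hwE : 0 ≤ w₀ + E := add_nonneg hw0.1 hE
  have hW0le : W₀ ≤ w₀ + E := by linarith [(abs_le.1 h0).1]
  have hW1le : W₁ ≤ w₁ + E + η := by linarith [(abs_le.1 h1).1]
  have hU0 : 0 ≤ W₀ ^ (1 / m) := Real.rpow_nonneg hW0.1 _
  have hκE : 0 ≤ κ * E / S ^ m := by positivity
  have hlW : lam * W₁ ≤ lam * (w₁ + E + η) := mul_le_mul_of_nonneg_left hW1le hlam
  rcases le_or_gt (w₀ + E) (S ^ m) with hcase | hcase
  · have hsS : (w₀ + E) ^ (1 / m) ≤ S := by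
      rw [← hrootS]; exact Real.rpow_le_rpow hwE hcase hmi
    have := sub_mul_rpow_mono hm hlam hcfl hU0 (Real.rpow_le_rpow hW0.1 hW0le hmi) hsS
    rw [hroot hW0.1, hroot hwE] at this
    linarith
  · have hUS : W₀ ^ (1 / m) ≤ S := by
      rw [← hrootS]; exact Real.rpow_le_rpow hW0.1 hW0.2 hmi
    have hg := sub_mul_rpow_mono hm hlam hcfl hU0 hUS le_rfl
    rw [hroot hW0.1] at hg
    set s := (w₀ + E) ^ (1 / m) with hs
    have hsm : s ^ m = w₀ + E := hroot hwE
    have hSs : S ≤ s := by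
      rw [← hrootS]; exact Real.rpow_le_rpow hSm.le hcase.le hmi
    have hs0 : 0 < s := hS.trans_le hSs
    have hwE' : 0 < w₀ + E := hSm.trans hcase
    set θ := S ^ m / (w₀ + E) with hθ
    have hθ0 : 0 ≤ θ := by positivity
    have hθ1 : θ ≤ 1 := (div_le_one hwE').2 hcase.le
    -- Reducing `λ` to `θ λ` is free here, as `W₁ ≤ S^m`. It restores the CFL condition up to the
    -- level `s`, because `m s^(m-1) θ λ = m S^(m-1) λ · S/s ≤ 1`. The price is `(1 - θ)` times the
    -- flux, which is `O(κ E)`.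
    have k1 : lam * (W₁ - S ^ m) ≤ θ * lam * (W₁ - S ^ m) := by
      have := mul_nonneg hlam (sub_nonneg.2 hW1.2)
      nlinarith
    have k2 : θ * lam * (W₁ - S ^ m) ≤ θ * lam * (w₁ + E + η - S ^ m) :=
      mul_le_mul_of_nonneg_left (by linarith) (mul_nonneg hθ0 hlam)
    have k3 : θ * lam * (w₀ + E - S ^ m) ≤ s - S := by
      have h2 := rpow_sub_rpow_le hS.le hSs hm
      rw [hsm] at h2
      have h3 : θ * lam * (w₀ + E - S ^ m) ≤ θ * lam * (m * s ^ (m - 1) * (s - S)) :=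
        mul_le_mul_of_nonneg_left h2 (mul_nonneg hθ0 hlam)
      have e1 : S ^ m = S ^ (m - 1) * S := by
        rw [← Real.rpow_add_one hS.ne', sub_add_cancel]
      have e2 : w₀ + E = s ^ (m - 1) * s := by
        rw [← hsm, ← Real.rpow_add_one hs0.ne', sub_add_cancel]
      have hsp : 0 < s ^ (m - 1) := Real.rpow_pos_of_pos hs0 _
      have e3 : θ * lam * (m * s ^ (m - 1) * (s - S))
          = (m * S ^ (m - 1) * lam) * (S / s) * (s - S) := by
        rw [hθ, e1, e2]
        field_simp
      have h4 : (m * S ^ (m - 1) * lam) * (S / s) ≤ 1 * 1 :=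
        mul_le_mul hcfl ((div_le_one hs0).2 hSs) (by positivity) zero_le_one
      have h5 := mul_le_mul_of_nonneg_right h4 (sub_nonneg.2 hSs)
      linarith
    have k4 : (1 - θ) * (lam * (w₀ - w₁)) ≤ κ * E / S ^ m := by
      have h2 : 1 - θ ≤ E / S ^ m := by
        have : 1 - θ = (w₀ + E - S ^ m) / (w₀ + E) := by rw [hθ]; field_simp
        rw [this]
        exact div_le_div₀ hE (by linarith [hw0.2]) hSm hcase.le
      calc _ ≤ (1 - θ) * κ := mul_le_mul_of_nonneg_left hflux (by linarith)
        _ ≤ E / S ^ m * κ := mul_le_mul_of_nonneg_right h2 hκ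
        _ = _ := by ring
    have k5 : θ * (lam * η) ≤ lam * η :=
      mul_le_of_le_one_left (mul_nonneg hlam hη) hθ1
    linarith

/-- The error of the powers after one explicit step. -/
theorem explicit_step_error {m lam S w₀ w₁ W₀ W₁ E η κ τ γ v : ℝ} (hm : 1 ≤ m) (hlam : 0 ≤ lam)
    (hS : 0 ≤ S) (hcfl : m * S ^ (m - 1) * lam ≤ 1) (hw0 : w₀ ∈ Icc 0 (S ^ m))
    (hW0 : W₀ ∈ Icc 0 (S ^ m)) (hW1 : W₁ ∈ Icc 0 (S ^ m)) (hE : 0 ≤ E) (hη : 0 ≤ η)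
    (h0 : |w₀ - W₀| ≤ E) (h1 : |w₁ - W₁| ≤ E + η) (hκ : 0 ≤ κ) (hflux : lam * (w₀ - w₁) ≤ κ)
    (hv : v ∈ Icc 0 S) (hτ : |v - (w₀ ^ (1 / m) + lam * (w₁ - w₀))| ≤ τ) (hγ : 1 ≤ γ)
    (hgrowth : m = 1 ∨ v ≤ γ * w₀ ^ (1 / m)) :
    |v ^ m - (lam * (W₁ - W₀) + W₀ ^ (1 / m)) ^ m|
      ≤ γ ^ m * E + m * S ^ (m - 1) * (τ + lam * η + κ * E / S ^ m) := by
  have hm0 : m ≠ 0 := by linarith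
  have hmi : 0 ≤ 1 / m := by positivity
  have hτ0 : 0 ≤ τ := (abs_nonneg _).trans hτ
  have hγm : 1 ≤ γ ^ m := Real.one_le_rpow hγ (by linarith)
  have hEγ : E ≤ γ ^ m * E := le_mul_of_one_le_left hE hγm
  have hSm : 0 ≤ S ^ m := Real.rpow_nonneg hS _
  have hκE : 0 ≤ κ * E / S ^ m := by positivity
  have hlη : 0 ≤ lam * η := mul_nonneg hlam hη
  have herr : 0 ≤ τ + lam * η + κ * E / S ^ m := by positivity
  have hV := explicit_step_mem hm hlam hS hcfl hW0 hW1
  obtain ⟨τ1, τ2⟩ := abs_le.1 hτ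
  obtain ⟨a1, a2⟩ := abs_le.1 h0
  obtain ⟨b1, b2⟩ := abs_le.1 h1
  -- For `S = 0` everything vanishes; this disposes of the quotient by `S^m`.
  rcases hS.eq_or_lt with rfl | hS0
  · have e1 : v = 0 := le_antisymm hv.2 hv.1
    have e2 := le_antisymm hV.2 hV.1
    rw [e1, e2, sub_self, abs_zero]
    positivity
  rcases hgrowth with rfl | hgrowth
  -- The linear case needs no growth bound: the new error is a convex combination of the two old
  -- ones plus the truncation error.
  · simp only [sub_self, Real.rpow_zero, one_mul, div_one, Real.rpow_one] at *
    have h2 : (1 - lam) * |w₀ - W₀| ≤ (1 - lam) * E :=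
      mul_le_mul_of_nonneg_left h0 (by linarith)
    have h3 : lam * |w₁ - W₁| ≤ lam * (E + η) := mul_le_mul_of_nonneg_left h1 hlam
    have e : v - (lam * (W₁ - W₀) + W₀) = (v - (w₀ + lam * (w₁ - w₀)))
        + (1 - lam) * (w₀ - W₀) + lam * (w₁ - W₁) := by ring
    rw [e]
    refine (abs_add_three _ _ _).trans ?_
    rw [abs_mul, abs_mul, abs_of_nonneg hlam, abs_of_nonneg (show 0 ≤ 1 - lam by linarith)]
    linarith
  have hroot : ∀ {b : ℝ}, 0 ≤ b → (b ^ (1 / m)) ^ m = b := fun {b} hb => by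
    rw [← Real.rpow_mul hb, one_div_mul_cancel hm0, Real.rpow_one]
  set u := w₀ ^ (1 / m) with hu
  have hu0 : 0 ≤ u := Real.rpow_nonneg hw0.1 _
  have hum : u ^ m = w₀ := hroot hw0.1
  set V := lam * (W₁ - W₀) + W₀ ^ (1 / m) with hVdef
  rw [abs_le']
  constructor
  -- If `w₀ < E`, the root of `w₀ - E` is unavailable, but then the whole of `v^m ≤ γ^m w₀` is
  -- already below `γ^m E`.
  · rcases lt_or_ge w₀ E with hcase | hcase
    · have h2 : v ^ m ≤ γ ^ m * w₀ := by
        rw [← hum, ← Real.mul_rpow (by linarith) hu0]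
        exact Real.rpow_le_rpow hv.1 hgrowth (by linarith)
      have h3 : γ ^ m * w₀ ≤ γ ^ m * E := mul_le_mul_of_nonneg_left hcase.le (by linarith)
      have h4 : 0 ≤ V ^ m := Real.rpow_nonneg hV.1 _
      have h5 : 0 ≤ m * S ^ (m - 1) * (τ + lam * η + κ * E / S ^ m) := by positivity
      linarith
    · have hwE : 0 ≤ w₀ - E := sub_nonneg.2 hcase
      set r := (w₀ - E) ^ (1 / m) with hr
      have hr0 : 0 ≤ r := Real.rpow_nonneg hwE _
      have hrm : r ^ m = w₀ - E := hroot hwE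
      have hru : r ≤ u := Real.rpow_le_rpow hwE (by linarith) hmi
      have hVlow : v - (u - r) - (τ + lam * η) ≤ V := by
        have hUS : W₀ ^ (1 / m) ≤ S := by
          have := Real.rpow_le_rpow hW0.1 hW0.2 hmi
          rwa [← Real.rpow_mul hS, mul_one_div_cancel hm0, Real.rpow_one] at this
        have h2 := sub_mul_rpow_mono hm hlam hcfl hr0
          (Real.rpow_le_rpow hwE (by linarith : w₀ - E ≤ W₀) hmi) hUS
        rw [hrm, hroot hW0.1] at h2
        have h3 : lam * (w₁ - E - η) ≤ lam * W₁ := mul_le_mul_of_nonneg_left (by linarith) hlam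
        rw [hVdef]
        linarith
      rcases le_total 0 (v - (u - r)) with hb | hb
      · have h2 := shift_down_rpow_le hm hγ hr0 hru hb hgrowth
        have h3 := rpow_sub_rpow_le_of_le_add (S := S)
          (e := τ + lam * η + κ * E / S ^ m) hm hV.1 hb (by linarith [hv.2]) herr (by linarith)
        rw [hum, hrm, sub_sub_cancel] at h2
        linarith
      -- Superadditivity of `s^m` gives `(u - r)^m ≤ u^m - r^m = E`.
      · have h2 : v ^ m ≤ (u - r) ^ m := Real.rpow_le_rpow hv.1 (by linarith) (by linarith)
        have h3 := Real.add_rpow_le_rpow_add (sub_nonneg.2 hru) hr0 hm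
        rw [sub_add_cancel, hum, hrm] at h3
        have h4 : 0 ≤ V ^ m := Real.rpow_nonneg hV.1 _
        have h5 : 0 ≤ m * S ^ (m - 1) * (τ + lam * η + κ * E / S ^ m) := by positivity
        linarith
  · have h2 := explicit_step_upper hm hlam hS0 hcfl hw0 hW0 hW1 hE hη h0 h1 hκ hflux
    have hus : u ≤ (w₀ + E) ^ (1 / m) := Real.rpow_le_rpow hw0.1 (by linarith) hmi
    have h3 := shift_up_rpow_le hm hγ hu0 hus hv.1 hgrowth
    rw [hum, hroot (add_nonneg hw0.1 hE), add_sub_cancel_left] at h3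
    have h4 := rpow_sub_rpow_le_of_le_add (S := S) (a := v + ((w₀ + E) ^ (1 / m) - u))
      (e := τ + lam * η + κ * E / S ^ m) hm
      (add_nonneg hv.1 (sub_nonneg.2 hus)) hV.1 hV.2 herr (by linarith)
    linarith

/-! ### Convergence -/

section Convergence

variable {σ m X Y T a δ S : ℝ} {f : ℝ → ℝ} {w : ℝ → ℝ → ℝ → ℝ} {LD : Discretization X Y}
  {R : Set (ℝ → ℝ → ℝ → ℝ)}

lemma rpow_le_const_mul_rpow {p q h Y : ℝ} (hh : 0 < h) (hhY : h ≤ Y) (hpq : q ≤ p) :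
    h ^ p ≤ Y ^ (p - q) * h ^ q := by
  calc h ^ p = h ^ (p - q) * h ^ q := by rw [← Real.rpow_add hh, sub_add_cancel]
    _ ≤ _ := mul_le_mul_of_nonneg_right (Real.rpow_le_rpow hh.le hhY (by linarith))
      (by positivity)

lemma exp_add_le_exp_add {b c : ℝ} (hb : 0 ≤ b) (hc : 0 ≤ c) :
    Real.exp b + c ≤ Real.exp (b + c) := by
  rw [Real.exp_add]
  calc Real.exp b + c ≤ Real.exp b + Real.exp b * c :=
        add_le_add_right (le_mul_of_one_le_left hc (Real.one_le_exp hb)) _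
    _ = Real.exp b * (c + 1) := by ring
    _ ≤ _ := mul_le_mul_of_nonneg_left (Real.add_one_le_exp c) (Real.exp_pos b).le

/-- Truncation error of the explicit step for the exact solution, and a bound of the flux. -/
theorem IsRegular.exists_truncation (hreg : IsRegular σ m X Y T w)
    (hw : IsClassicalSolution σ m X Y T f w) (hσ : σ ∈ Ioo (0 : ℝ) 2) (hX : 0 < X) (hY : 0 < Y)
    (hT : 0 < T) (hS : 0 ≤ S)
    (hbase : ∀ x ∈ Icc (-X) X, ∀ t ∈ Icc 0 T, w x 0 t ≤ S) :
    ∃ C ≥ 0, ∃ C₁ ≥ 0, ∀ x ∈ Ioo (-X) X, ∀ t ∈ Icc 0 T, ∀ s ∈ Icc 0 T, t ≤ s → ∀ h ∈ Ioc 0 Y,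
      |w x 0 s ^ (1 / m) - (w x 0 t ^ (1 / m)
          + nuConst σ * ((s - t) / h ^ σ) * (w x h t - w x 0 t))|
        ≤ C * (s - t) * ((s - t) + h ^ (2 - σ)) ∧
      nuConst σ * ((s - t) / h ^ σ) * (w x 0 t - w x h t) ≤ C₁ * (s - t) := by
  obtain ⟨C, hC0, hC⟩ := hreg.exists_flux_consistency hw hσ hX hY hT
  obtain ⟨B, hB0, hB⟩ := hreg.exists_taylor hX hT
  have hν := nuConst_pos hσ
  have h2σ : 0 < 2 - σ := by linarith [hσ.2]
  refine ⟨B + C, add_nonneg hB0 hC0,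
    nuConst σ / Y ^ σ * S + C * Y ^ (2 - σ) + C * Y ^ (2 - σ), by positivity, ?_⟩
  intro x hx t ht s hs hts h hh
  have hx' := Ioo_subset_Icc_self hx
  have hst : 0 ≤ s - t := sub_nonneg.2 hts
  have hhp : 0 ≤ h ^ (2 - σ) := Real.rpow_nonneg hh.1.le _
  set d := derivWithin (fun τ => w x 0 τ ^ (1 / m)) (Icc 0 T) t with hd
  have hCh := hC x hx t ht h hh
  constructor
  · have h1 := hB x hx' t ht s hs hts
    have h2 := mul_le_mul_of_nonneg_left hCh hst
    rw [← abs_of_nonneg hst, ← abs_mul, abs_of_nonneg hst] at h2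
    have e : w x 0 s ^ (1 / m) - (w x 0 t ^ (1 / m)
          + nuConst σ * ((s - t) / h ^ σ) * (w x h t - w x 0 t))
        = (w x 0 s ^ (1 / m) - w x 0 t ^ (1 / m) - (s - t) * d)
          + (s - t) * (d - nuConst σ / h ^ σ * (w x h t - w x 0 t)) := by ring
    rw [e]
    refine (abs_add_le _ _).trans ((add_le_add h1 h2).trans ?_)
    have := mul_nonneg hC0 (mul_nonneg hst hst)
    have := mul_nonneg hB0 (mul_nonneg hst hhp)
    nlinarith
  -- The consistency estimate at `h = Y`, where `w` vanishes, bounds `∂_t u` from below; the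
  -- estimate at `h` then turns this into a bound for the flux uniform in `h`.
  · have h1 := (abs_le.1 (hC x hx t ht Y ⟨hY, le_rfl⟩)).1
    rw [hw.top_zero x hx' t ht] at h1
    have h2 : nuConst σ / Y ^ σ * w x 0 t ≤ nuConst σ / Y ^ σ * S :=
      mul_le_mul_of_nonneg_left (hbase x hx' t ht) (by positivity)
    have h3 : C * h ^ (2 - σ) ≤ C * Y ^ (2 - σ) :=
      mul_le_mul_of_nonneg_left (Real.rpow_le_rpow hh.1.le hh.2 h2σ.le) hC0
    have h4 : nuConst σ / h ^ σ * (w x 0 t - w x h t)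
        ≤ nuConst σ / Y ^ σ * S + C * Y ^ (2 - σ) + C * Y ^ (2 - σ) := by
      have := (abs_le.1 hCh).2
      linarith
    calc _ = nuConst σ / h ^ σ * (w x 0 t - w x h t) * (s - t) := by ring
      _ ≤ _ := mul_le_mul_of_nonneg_right h4 hst

set_option maxHeartbeats 800000 in
/-- The error on the base, at all time levels. -/
theorem exists_base_error (hσ : σ ∈ Ioo (0 : ℝ) 2) (hm : 1 ≤ m) (hX : 0 < X) (hY : 0 < Y)
    (hT : 0 < T) (hw : IsClassicalSolution σ m X Y T f w) (hreg : IsRegular σ m X Y T w)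
    (ha : σ + δ ≤ a) (hS : 0 ≤ S) (hf : ∀ x ∈ Icc (-X) X, 0 ≤ f x ∧ f x ≤ S)
    (hbase : ∀ x ∈ Icc (-X) X, ∀ t ∈ Icc 0 T, w x 0 t ^ (1 / m) ≤ S)
    (hmax : LD.MaxPrinciple) {Cₑ : ℝ} (hCₑ : 0 ≤ Cₑ) :
    ∃ C ≥ 0, ∀ (M : Mesh X Y) (J : ℕ), 0 < J →
      m * S ^ (m - 1) * (nuConst σ * ((T / J) / M.dx ^ σ)) ≤ 1 →
      ∀ W : ℕ → M.Grid, IsNumericalSolution LD σ m T f M J W →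
      (∀ j ≤ J, ∀ t ∈ Icc 0 T, ∀ E ≥ 0,
        (∀ i : Fin (M.I + 1), 0 < (i : ℕ) → (i : ℕ) < M.I → |w (M.xNode i) 0 t - W j i 0| ≤ E) →
        ∀ i k, |w (M.xNode i) (M.yNode k) t - W j i k| ≤ E + Cₑ * M.dx ^ a) →
      ∀ i : Fin (M.I + 1), 0 < (i : ℕ) → (i : ℕ) < M.I →
        |w (M.xNode i) 0 T - W J i 0| ≤ C * (T / J + M.dx ^ (2 - σ) + M.dx ^ δ) := by
  have hm0 : m ≠ 0 := by linarith
  have hν := nuConst_pos hσ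
  have hSm : 0 ≤ S ^ m := Real.rpow_nonneg hS _
  have h0Y : (0 : ℝ) ∈ Icc 0 Y := ⟨le_rfl, hY.le⟩
  have hroot : ∀ {b : ℝ}, 0 ≤ b → (b ^ (1 / m)) ^ m = b := fun {b} hb => by
    rw [← Real.rpow_mul hb, one_div_mul_cancel hm0, Real.rpow_one]
  have hbm : ∀ x ∈ Icc (-X) X, ∀ t ∈ Icc 0 T, w x 0 t ≤ S ^ m := fun x hx t ht => by
    have h1 := hw.nonneg x hx 0 h0Y t ht
    rw [← hroot h1]
    exact Real.rpow_le_rpow (Real.rpow_nonneg h1 _) (hbase x hx t ht) (by linarith)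
  obtain ⟨C, hC0, C₁, hC₁0, hC⟩ := hreg.exists_truncation hw hσ hX hY hT hSm hbm
  obtain ⟨C₀, hC₀0, hC₀⟩ : ∃ C₀ ≥ 0, ∀ x ∈ Ioo (-X) X, ∀ t ∈ Icc 0 T, ∀ s ∈ Icc 0 T, t ≤ s →
      m = 1 ∨ w x 0 s ^ (1 / m) ≤ Real.exp (C₀ * (s - t)) * w x 0 t ^ (1 / m) := by
    rcases hm.eq_or_lt with h | h
    · exact ⟨0, le_rfl, fun _ _ _ _ _ _ _ => Or.inl h.symm⟩
    · obtain ⟨C₀, h1, h2⟩ := hreg.exists_growth hw hσ h hX hY hT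
      exact ⟨C₀, h1, fun x hx t ht s hs hts => Or.inr (h2 x hx t ht s hs hts)⟩
  set P := m * S ^ (m - 1) with hP
  have hP0 : 0 ≤ P := by positivity
  set C₃ := P * C₁ / S ^ m with hC₃
  have hC₃0 : 0 ≤ C₃ := by positivity
  set C₂ := C + nuConst σ * Cₑ * Y ^ (a - σ - δ) with hC₂
  have hC₂0 : 0 ≤ C₂ := by positivity
  set C₄ := P * C₂ with hC₄
  have hC₄0 : 0 ≤ C₄ := by positivity
  -- The growth rate per unit time: `m C₀` comes from `γ^m`, and `C₃` from the flux term `κ E / S^m`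
  -- with `κ = C₁ Δt`.
  set L := m * C₀ + C₃ with hL
  have hL0 : 0 ≤ L := by positivity
  refine ⟨Real.exp (L * T) * (C₄ * T), by positivity, ?_⟩
  intro M J hJ hcfl W hW herr
  have hdx := M.dx_pos hX
  have hdxY := M.dx_le hX
  have hJ' : (0 : ℝ) < J := by exact_mod_cast hJ
  set dt := T / J with hdt
  have hdt0 : 0 < dt := by positivity
  have hJdt : J * dt = T := by rw [hdt]; field_simp
  set lam := nuConst σ * (dt / M.dx ^ σ) with hlam
  have hlam0 : 0 ≤ lam := by positivity
  set ρ := dt + M.dx ^ (2 - σ) + M.dx ^ δ with hρ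
  have hρ0 : 0 ≤ ρ := by positivity
  have hbd := hW.mem_Icc hmax hm hS hf hX hlam0 hcfl
  have htime : ∀ j ≤ J, (j : ℝ) * dt ∈ Icc 0 T := by
    intro j hj
    refine ⟨by positivity, ?_⟩
    rw [← hJdt]
    exact mul_le_mul_of_nonneg_right (by exact_mod_cast hj) hdt0.le
  have key : ∀ j ≤ J, ∀ i : Fin (M.I + 1), 0 < (i : ℕ) → (i : ℕ) < M.I →
      |w (M.xNode i) 0 (j * dt) - W j i 0| ≤ Real.exp (L * (j * dt)) * (C₄ * (j * dt) * ρ) := by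
    intro j
    induction j with
    | zero =>
      intro _ i h0 hI
      rw [hW.initial i h0 hI, Nat.cast_zero, zero_mul,
        hw.initial _ (M.xNode_mem hX i), sub_self, abs_zero]
      simp
    | succ j ih =>
      intro hj i h0 hI
      have hj' : j ≤ J := by omega
      set E := Real.exp (L * (j * dt)) * (C₄ * (j * dt) * ρ) with hE
      have hE0 : 0 ≤ E := by positivity
      have hx := M.xNode_mem_Ioo hX h0 hI
      have hx' := M.xNode_mem hX i
      have ht := htime j hj'
      have hs := htime (j + 1) hj
      have hsub : ((j + 1 : ℕ) : ℝ) * dt - j * dt = dt := by push_cast; ring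
      have hts : (j : ℝ) * dt ≤ ((j + 1 : ℕ) : ℝ) * dt := by linarith
      have hall := herr j hj' _ ht E hE0 (ih hj')
      have e1 := hall i M.kOne
      rw [M.yNode_kOne] at e1
      obtain ⟨t1, t2⟩ := hC _ hx _ ht _ hs hts M.dx ⟨hdx, hdxY⟩
      have hgr := hC₀ _ hx _ ht _ hs hts
      rw [hsub] at t1 t2 hgr
      have hws := hw.nonneg _ hx' 0 h0Y _ hs
      have step := explicit_step_error hm hlam0 hS hcfl
        ⟨hw.nonneg _ hx' 0 h0Y _ ht, hbm _ hx' _ ht⟩ (hbd j hj' i 0) (hbd j hj' i M.kOne) hE0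
        (by positivity) (ih hj' i h0 hI) e1 (by positivity) t2
        ⟨Real.rpow_nonneg hws _, hbase _ hx' _ hs⟩ t1 (Real.one_le_exp (by positivity)) hgr
      rw [hroot hws, ← hW.step j (by omega) i h0 hI, ← Real.exp_mul] at step
      refine step.trans ?_
      -- The factor `Δx^(-σ)` in `λ` costs `σ` orders of the interior residual; at least `δ` orders
      -- remain.
      have hη : lam * (Cₑ * M.dx ^ a) ≤ nuConst σ * Cₑ * Y ^ (a - σ - δ) * dt * M.dx ^ δ := by
        have h1 : lam * (Cₑ * M.dx ^ a) = nuConst σ * Cₑ * dt * M.dx ^ (a - σ) := by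
          rw [hlam, Real.rpow_sub hdx]; ring
        have h2 := rpow_le_const_mul_rpow hdx hdxY (show δ ≤ a - σ by linarith)
        rw [h1]
        calc _ ≤ nuConst σ * Cₑ * dt * (Y ^ (a - σ - δ) * M.dx ^ δ) :=
              mul_le_mul_of_nonneg_left h2 (by positivity)
          _ = _ := by ring
      have hsum : C * dt * (dt + M.dx ^ (2 - σ)) + lam * (Cₑ * M.dx ^ a) ≤ C₂ * dt * ρ := by
        have p1 : 0 ≤ C * dt * M.dx ^ δ := by positivity
        have p2 : 0 ≤ nuConst σ * Cₑ * Y ^ (a - σ - δ) * dt * (dt + M.dx ^ (2 - σ)) := by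
          positivity
        rw [hC₂, hρ]
        linarith
      have hsum' := mul_le_mul_of_nonneg_left hsum hP0
      have hexp2 : Real.exp (C₀ * dt * m) + C₃ * dt ≤ Real.exp (L * dt) := by
        rw [show L * dt = C₀ * dt * m + C₃ * dt by rw [hL]; ring]
        exact exp_add_le_exp_add (by positivity) (by positivity)
      have hexp3 : 1 ≤ Real.exp (L * (((j + 1 : ℕ) : ℝ) * dt)) := Real.one_le_exp (by positivity)
      have hexp4 : Real.exp (L * (((j + 1 : ℕ) : ℝ) * dt))
          = Real.exp (L * dt) * Real.exp (L * (j * dt)) := by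
        rw [← Real.exp_add]; congr 1; push_cast; ring
      have hfin : Real.exp (L * (((j + 1 : ℕ) : ℝ) * dt)) * (C₄ * (((j + 1 : ℕ) : ℝ) * dt) * ρ)
          = Real.exp (L * dt) * E
            + Real.exp (L * (((j + 1 : ℕ) : ℝ) * dt)) * (C₄ * dt * ρ) := by
        rw [hE, hexp4]; push_cast; ring
      rw [hfin]
      have h1 := mul_le_mul_of_nonneg_right hexp2 hE0
      have h2 : C₄ * dt * ρ ≤ Real.exp (L * (((j + 1 : ℕ) : ℝ) * dt)) * (C₄ * dt * ρ) :=
        le_mul_of_one_le_left (by positivity) hexp3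
      have h3 : P * (C₁ * dt * E / S ^ m) = C₃ * dt * E := by rw [hC₃]; ring
      have h4 : P * (C₂ * dt * ρ) = C₄ * dt * ρ := by rw [hC₄]; ring
      rw [mul_add P, h3]
      linarith
  intro i h0 hI
  have := key J le_rfl i h0 hI
  rw [hJdt] at this
  rw [mul_assoc]
  exact this

end Convergence

end FracPME

theorem mainTheorem8
    (σ m X Y T : ℝ) (hσ : σ ∈ Set.Ioo (0 : ℝ) 2) (hm : 1 ≤ m)
    (hX : 0 < X) (hY : 0 < Y) (hT : 0 < T)
    (f : ℝ → ℝ) (hf : ∀ x ∈ Set.Icc (-X) X, 0 ≤ f x)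
    (w : ℝ → ℝ → ℝ → ℝ)
    (hw : FracPME.IsClassicalSolution σ m X Y T f w)
    (hreg : FracPME.IsRegular σ m X Y T w)
    (a δ D : ℝ) (hδ : 0 < δ) (ha : σ + δ ≤ a) (hD : 0 < D)
    (LD : FracPME.Discretization X Y) (hmax : LD.MaxPrinciple)
    -- the class of regular functions: it contains all smooth functions and the solution
    (R : Set (ℝ → ℝ → ℝ → ℝ))
    (hsmooth : ∀ v : ℝ → ℝ → ℝ, ContDiff ℝ ∞ (fun p : ℝ × ℝ => v p.1 p.2) →
      (fun x y _ => v x y) ∈ R)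
    (hwR : w ∈ R) (hord : LD.HasOrder σ T a R) :
    ∃ C : ℝ, ∀ (M : FracPME.Mesh X Y) (J : ℕ), 0 < J →
      D * M.dx ^ (a - δ) ≤ T / J → FracPME.CFL σ m X f (T / J) M.dx →
      ∀ W : ℕ → M.Grid, FracPME.IsNumericalSolution LD σ m T f M J W →
        FracPME.errorF T w M J W J ≤ C * (T / J + M.dx ^ (2 - σ) + M.dx ^ δ) := by
  have ha0 : 0 < a := by linarith [hσ.1]
  have h0X : (0 : ℝ) ∈ Icc (-X) X := ⟨by linarith, hX.le⟩
  have h0Y : (0 : ℝ) ∈ Icc 0 Y := ⟨le_rfl, hY.le⟩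
  have hTT : T ∈ Icc 0 T := ⟨hT.le, le_rfl⟩
  set S := sSup (f '' Icc (-X) X) with hSdef
  have hfS : ∀ x ∈ Icc (-X) X, 0 ≤ f x ∧ f x ≤ S := fun x hx =>
    ⟨hf x hx, hw.le_sSup hm hY hT hf hx⟩
  have hS : 0 ≤ S := (hfS 0 h0X).1.trans (hfS 0 h0X).2
  have hSm : 0 ≤ S ^ m := Real.rpow_nonneg hS _
  have hbase : ∀ x ∈ Icc (-X) X, ∀ t ∈ Icc 0 T, w x 0 t ^ (1 / m) ≤ S := fun x hx t ht =>
    hw.base_le hσ hm hX hY hT hf hx ht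
  have hwT : ∀ x ∈ Icc (-X) X, ∀ y ∈ Icc 0 Y, w x y T ≤ S ^ m := by
    refine hw.le_of_base_le hX hY ⟨hT, le_rfl⟩ hSm fun x hx => ?_
    have h1 := hw.nonneg x hx 0 h0Y T hTT
    have := Real.rpow_le_rpow (Real.rpow_nonneg h1 _) (hbase x hx T hTT) (show 0 ≤ m by linarith)
    rwa [← Real.rpow_mul h1, one_div_mul_cancel (by linarith), Real.rpow_one] at this
  obtain ⟨Cₑ, hCₑ, h₁, hh₁, herr⟩ :=
    FracPME.exists_error_le_base hmax hσ hX hY hT ha0 hsmooth hord hwR hw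
  obtain ⟨C, hC0, hC⟩ :=
    FracPME.exists_base_error hσ hm hX hY hT hw hreg ha hS hfS hbase hmax hCₑ
  -- The terms account for the base error, the interior residual, and the coarse meshes `Δx > h₁`.
  -- On the latter consistency says nothing, but `w` and `W` both lie in `[0, S^m]` and `Δx^δ ≥
  -- h₁^δ`.
  refine ⟨C + Cₑ * Y ^ (a - δ) + S ^ m / h₁ ^ δ, ?_⟩
  intro M J hJ _ hcfl W hW
  have hdx := M.dx_pos hX
  have hdxY := M.dx_le hX
  have hJ' : (0 : ℝ) < J := by exact_mod_cast hJ
  have hcfl' := FracPME.CFL.mul_le_one hdx hcfl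
  have hJT : (J : ℝ) * (T / J) = T := by field_simp
  have hν := FracPME.nuConst_pos hσ
  set ρ := T / J + M.dx ^ (2 - σ) + M.dx ^ δ with hρ
  have hdδ : M.dx ^ δ ≤ ρ := by
    have : 0 ≤ T / J + M.dx ^ (2 - σ) := by positivity
    linarith
  have hρ0 : 0 ≤ ρ := (Real.rpow_nonneg hdx.le _).trans hdδ
  have hh₁δ : 0 < h₁ ^ δ := Real.rpow_pos_of_pos hh₁ _
  unfold FracPME.errorF
  refine ciSup_le fun p => ?_
  rw [hJT]
  rcases le_or_gt M.dx h₁ with hM | hM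
  · have herr' := fun j (hj : j ≤ J) =>
      herr M hM (W j) (hW.interior_eq j hj) (hW.lateral j hj)
    have hb := hC M J hJ hcfl' W hW herr'
    refine (herr' J le_rfl T hTT (C * ρ) (mul_nonneg hC0 hρ0) hb p.1 p.2).trans ?_
    have h2 := FracPME.rpow_le_const_mul_rpow hdx hdxY (show δ ≤ a by linarith [hσ.1])
    have h3 : Cₑ * M.dx ^ a ≤ Cₑ * Y ^ (a - δ) * ρ := by
      calc _ ≤ Cₑ * (Y ^ (a - δ) * ρ) := mul_le_mul_of_nonneg_left
            (h2.trans (mul_le_mul_of_nonneg_left hdδ (by positivity))) hCₑ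
        _ = _ := by ring
    have h4 : 0 ≤ S ^ m / h₁ ^ δ * ρ := by positivity
    linarith
  · have hx := M.xNode_mem hX p.1
    have hy := M.yNode_mem hX p.2
    have hWm := hW.mem_Icc hmax hm hS hfS hX (by positivity) hcfl' J le_rfl p.1 p.2
    have h1 := hw.nonneg _ hx _ hy T hTT
    have h2 := hwT _ hx _ hy
    have h3 : |w (M.xNode p.1) (M.yNode p.2) T - W J p.1 p.2| ≤ S ^ m := by
      rw [abs_le]
      constructor <;> linarith [hWm.1, hWm.2]
    have h4 : h₁ ^ δ ≤ ρ := (Real.rpow_le_rpow hh₁.le hM.le hδ.le).trans hdδ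
    have h5 : S ^ m ≤ S ^ m / h₁ ^ δ * ρ := by
      rw [div_mul_eq_mul_div, le_div_iff₀ hh₁δ]
      exact mul_le_mul_of_nonneg_left h4 hSm
    have h6 : 0 ≤ C * ρ := mul_nonneg hC0 hρ0
    have h7 : 0 ≤ Cₑ * Y ^ (a - δ) * ρ := by positivity
    linarith
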